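/- Let $p$ be a prime, let $V$ be a vector space over $\mathbb{F}_p$ of dimension $2$, and let $G \subseteq \mathrm{GL}(V)$ be a subgroup, acting on $V$ tautologically and on $\mathrm{End}(V)$ by conjugation. Then the following are equivalent. (1) (i) $V$ and $\mathrm{End}(V)$ have no common irreducible factor as $G$-modules (that is, no irreducible $\mathbb{F}_p[G]$-module is isomorphic to a subquotient of both), and (ii) $H^1(G,V)=0$. (2) (i) $G$ is not contained in a subgroup of $\mathrm{GL}(V)$ that is isomorphic to the symmetric group $S_3$, and (ii) if $V$ is a reducible $G$-module, namely an extension $0 \to \chi_1 \to V \to \chi_2 \to 0$ of $G$-modules for characters $\chi_1,\chi_2 : G \to \mathbb{F}_p^\ast$, then $\chi_1 \neq \mathbf{1}$, $\chi_1 \neq \chi_2^2$, $\chi_2 \neq \mathbf{1}$ and $\chi_2 \neq \chi_1^2$. Moreover, condition (2)(i) implies $p > 2$. -/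

import Mathlib

universe u

/-- The tautological representation on `V` of a subgroup `G` of `GL(V)`. -/
def tautologicalRep {k V : Type*} [CommRing k] [AddCommGroup V] [Module k V]
    (G : Subgroup (LinearMap.GeneralLinearGroup k V)) : Representation k G V :=
  (Units.coeHom (Module.End k V)).comp G.subtype

/-- The one-dimensional representation on `k` attached to a character `χ : G → kˣ`. -/
def characterRep {k G : Type*} [CommRing k] [Group G] (χ : G →* kˣ) : Representation k G k :=
  (Algebra.lmul k k : k →* Module.End k k).comp ((Units.coeHom k).comp χ)

/-- `τ` is a subquotient of `ρ`: it is (isomorphic to) a quotient of a subrepresentation of `ρ`. -/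
def IsSubquotientRep {k G V W : Type*} [CommRing k] [Group G] [AddCommGroup V] [Module k V]
    [AddCommGroup W] [Module k W] (τ : Representation k G W) (ρ : Representation k G V) : Prop :=
  ∃ (U : Subrepresentation ρ) (f : U.toRepresentation.IntertwiningMap τ), Function.Surjective f

/-- `ρ` and `σ` have a common irreducible factor: some irreducible representation of `G` over `k`
is a subquotient of both. (Every subquotient of `ρ` is isomorphic to one living in the universe
of the space of `ρ`.) -/
def HaveCommonIrreducibleFactor {k G W : Type*} {V : Type u} [Field k] [Group G]
    [AddCommGroup V] [Module k V] [AddCommGroup W] [Module k W]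
    (ρ : Representation k G V) (σ : Representation k G W) : Prop :=
  ∃ (X : Type u) (_ : AddCommGroup X) (_ : Module k X) (τ : Representation k G X),
    τ.IsIrreducible ∧ IsSubquotientRep τ ρ ∧ IsSubquotientRep τ σ

/-- There is a short exact sequence `0 → χ₁ → ρ → χ₂ → 0` of representations of `G`. -/
def IsExtensionOfCharacters {k G V : Type*} [CommRing k] [Group G] [AddCommGroup V] [Module k V]
    (ρ : Representation k G V) (χ₁ χ₂ : G →* kˣ) : Prop :=
  ∃ (i : (characterRep χ₁).IntertwiningMap ρ) (q : ρ.IntertwiningMap (characterRep χ₂)),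
    Function.Injective i ∧ Function.Exact i q ∧ Function.Surjective q

/-! Negating (2) yields a common factor. If V is an extension of χ₂ by χ₁, then Hom(χ₂, χ₁) is a
submodule and Hom(χ₁, χ₂) a quotient of End(V), and the scalars give the trivial character. Each
forbidden relation makes one of these equal to χ₁ or χ₂
(`IsExtensionOfCharacters.haveCommonIrreducibleFactor`). If G lies in a copy of S₃, then either G
fixes a nonzero vector, or V is the plane spanned by three vectors of sum zero; sending these to the
three reflections embeds V in End(V).

Conversely, let V be reducible. The factors of V are χ₁, χ₂ and those of End(V) are χ₁χ₂⁻¹, 1,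
χ₂χ₁⁻¹, so (2)(ii) rules out every coincidence. Cohomology is killed one character at a time: the
common kernel P of χ₁ and χ₂ has abelian quotient, and G acts on P through χ₁χ₂⁻¹
(`exists_eq_sub_of_cocycle_character`).

Let V be irreducible; p is odd, since GL₂(𝔽₂) is itself S₃. If p divides |G|, there is a
transvection, and two conjugate ones produce -1 in G (`exists_eq_neg_one_of_pow_eq_one`). This
central element acts as -1 on V and trivially on End(V), so there is no common factor and H¹ = 0. If
p does not divide |G|, averaging gives H¹ = 0, and a common factor gives an equivariant embedding φ
of V in End(V). The commutator T of two basis elements of the image of φ transforms by the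
determinant; it forces the elements of determinant 1 to be among 1, r, r², and G then permutes three
vectors of sum zero (`exists_permuted_triple`), so it lies in an S₃. -/

open Representation

/-! ### Subquotients, irreducibility and common factors. -/

section General

variable {k G V W X : Type*} [Field k] [Group G] [AddCommGroup V] [Module k V]
  [AddCommGroup W] [Module k W] [AddCommGroup X] [Module k X]
  {ρ : Representation k G V} {σ : Representation k G W} {τ : Representation k G X}

theorem IsSubquotientRep.of_surjective (f : ρ.IntertwiningMap τ) (hf : Function.Surjective f) :
    IsSubquotientRep τ ρ := by
  refine ⟨⊤, LinearMap.intertwiningMap_of_isIntertwiningMap _ _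
    (f.toLinearMap ∘ₗ (⊤ : Subrepresentation ρ).toSubmodule.subtype) ?_, ?_⟩
  · intro g v
    exact f.isIntertwining _ _ g v
  · intro x
    obtain ⟨v, rfl⟩ := hf x
    exact ⟨⟨v, trivial⟩, rfl⟩

theorem IsSubquotientRep.of_injective (i : τ.IntertwiningMap ρ) (hi : Function.Injective i) :
    IsSubquotientRep τ ρ := by
  let e := LinearEquiv.ofInjective i.toLinearMap hi
  refine ⟨i.range, LinearMap.intertwiningMap_of_isIntertwiningMap _ _ e.symm.toLinearMap ?_, ?_⟩
  · intro g v
    obtain ⟨x, rfl⟩ := e.surjective v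
    have : i.range.toRepresentation g (e x) = e (τ g x) :=
      Subtype.ext (i.isIntertwining _ _ g x).symm
    change e.symm (i.range.toRepresentation g (e x)) = τ g (e.symm (e x))
    rw [this, e.symm_apply_apply, e.symm_apply_apply]
  · exact e.symm.surjective

theorem characterRep_apply (χ : G →* kˣ) (g : G) (a : k) :
    characterRep χ g a = (χ g : k) * a := rfl

theorem Representation.isIrreducible_of_forall [Nontrivial V]
    (h : ∀ U : Submodule k V, (∀ g, ∀ v ∈ U, ρ g v ∈ U) → U = ⊥ ∨ U = ⊤) : ρ.IsIrreducible where
  exists_pair_ne := ⟨⊥, ⊤, fun h => bot_ne_top (α := Submodule k V)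
    (congrArg Subrepresentation.toSubmodule h)⟩
  eq_bot_or_eq_top U := (h U.toSubmodule fun g _ hv => U.apply_mem_toSubmodule g hv).imp
    (fun h => Subrepresentation.toSubmodule_injective h)
    (fun h => Subrepresentation.toSubmodule_injective h)

theorem Representation.IsIrreducible.eq_bot_or_eq_top_of_stable (hρ : ρ.IsIrreducible)
    (U : Submodule k V) (hU : ∀ g, ∀ v ∈ U, ρ g v ∈ U) : U = ⊥ ∨ U = ⊤ :=
  (hρ.eq_bot_or_eq_top ⟨U, hU⟩).imp (congrArg Subrepresentation.toSubmodule)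
    (congrArg Subrepresentation.toSubmodule)

theorem Representation.IsIrreducible.nontrivial (hρ : ρ.IsIrreducible) : Nontrivial V := by
  by_contra h
  rw [not_nontrivial_iff_subsingleton] at h
  obtain ⟨a, b, hab⟩ := hρ.exists_pair_ne
  exact hab (Subrepresentation.toSubmodule_injective (Subsingleton.elim _ _))

theorem characterRep_isIrreducible (χ : G →* kˣ) : (characterRep χ).IsIrreducible :=
  isIrreducible_of_forall fun U _ => IsSimpleOrder.eq_bot_or_eq_top (α := Ideal k) U

/-- An irreducible subquotient of a representation with a finite filtration on whose graded pieces
the group acts through characters is given by one of these characters. -/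
theorem IsSubquotientRep.exists_smul_of_filtration (hτ : τ.IsIrreducible)
    (h : IsSubquotientRep τ ρ) (F : ℕ → Submodule k V) (χ : ℕ → G →* kˣ) (n : ℕ)
    (h0 : F 0 = ⊥) (hn : F n = ⊤)
    (hF : ∀ i < n, ∀ g, ∀ v ∈ F (i + 1), ρ g v - (χ i g : k) • v ∈ F i) :
    ∃ i < n, ∀ g x, τ g x = (χ i g : k) • x := by
  classical
  obtain ⟨U, f, hf⟩ := h
  have := hτ.nontrivial
  have hex : ∃ i, ∃ u : U.toSubmodule, (u : V) ∈ F i ∧ f u ≠ 0 := by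
    obtain ⟨x, hx⟩ := exists_ne (0 : X)
    obtain ⟨u, rfl⟩ := hf x
    exact ⟨n, u, by simp [hn], hx⟩
  -- At the first step of the filtration not killed by `f`, the step below is killed, so the group
  -- acts on the image by a single character. This image is nonzero and stable, hence everything.
  obtain ⟨u, hu, hfu⟩ := Nat.find_spec hex
  have hmin := fun m hm => Nat.find_min hex (m := m) hm
  have hlen : Nat.find hex ≤ n := Nat.find_min' hex (by
    obtain ⟨x, hx⟩ := exists_ne (0 : X)
    obtain ⟨u, rfl⟩ := hf x
    exact ⟨u, by simp [hn], hx⟩)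
  generalize Nat.find hex = m at *
  obtain _ | j := m
  · rw [h0, Submodule.mem_bot, ZeroMemClass.coe_eq_zero] at hu
    rw [hu] at hfu
    exact absurd (map_zero f) hfu
  refine ⟨j, hlen, ?_⟩
  let S : Submodule k X := ((F (j + 1)).comap U.toSubmodule.subtype).map f.toLinearMap
  have key : ∀ g, ∀ v : U.toSubmodule, (v : V) ∈ F (j + 1) → τ g (f v) = (χ j g : k) • f v := by
    intro g v hv
    have h1 := hmin j (Nat.lt_succ_self j)
    push Not at h1
    have h2 := h1 (U.toRepresentation g v - (χ j g : k) • v) (hF j hlen g v hv)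
    rwa [map_sub, map_smul, f.isIntertwining, sub_eq_zero] at h2
  have hS : S = ⊤ := by
    refine (hτ.eq_bot_or_eq_top_of_stable S ?_).resolve_left ?_
    · rintro g _ ⟨v, hv, rfl⟩
      exact (key g v hv).symm ▸ S.smul_mem _ ⟨v, hv, rfl⟩
    · intro hb
      have : f u ∈ S := ⟨u, hu, rfl⟩
      rw [hb] at this
      exact hfu this
  intro g x
  obtain ⟨v, hv, rfl⟩ : x ∈ S := hS ▸ trivial
  exact key g v hv

theorem HaveCommonIrreducibleFactor.of_character {V : Type} {k : Type} [Field k]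
    [AddCommGroup V] [Module k V] [Module k W] {ρ : Representation k G V}
    {σ : Representation k G W} (χ : G →* kˣ)
    (h1 : IsSubquotientRep (characterRep χ) ρ) (h2 : IsSubquotientRep (characterRep χ) σ) :
    HaveCommonIrreducibleFactor ρ σ :=
  ⟨k, _, _, characterRep χ, characterRep_isIrreducible χ, h1, h2⟩

theorem Subrepresentation.subtype_intertwining (U : Subrepresentation ρ) :
    ∀ g v, U.toSubmodule.subtype (U.toRepresentation g v) = ρ g (U.toSubmodule.subtype v) :=
  fun _ _ => rfl

/-- A nonzero subrepresentation of minimal dimension works. -/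
theorem exists_irreducible_subrepresentation [FiniteDimensional k V] [Nontrivial V]
    (ρ : Representation k G V) :
    ∃ U : Subrepresentation ρ, U.toRepresentation.IsIrreducible := by
  classical
  have hex : ∃ n, ∃ U : Subrepresentation ρ, U.toSubmodule ≠ ⊥ ∧
      Module.finrank k U.toSubmodule = n := ⟨_, ⊤, top_ne_bot, rfl⟩
  obtain ⟨U, hU, hn⟩ := Nat.find_spec hex
  refine ⟨U, ?_⟩
  have := (Submodule.nontrivial_iff_ne_bot).2 hU
  refine isIrreducible_of_forall fun S hS => or_iff_not_imp_left.2 fun hb => ?_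
  let S' : Subrepresentation ρ := ⟨S.map U.toSubmodule.subtype, by
    rintro g _ ⟨v, hv, rfl⟩
    exact ⟨_, hS g v hv, rfl⟩⟩
  have e : Module.finrank k S'.toSubmodule = Module.finrank k S :=
    (Submodule.equivMapOfInjective _ U.toSubmodule.subtype_injective S).finrank_eq.symm
  have h1 := Nat.find_min' hex ⟨S', by
    change S.map U.toSubmodule.subtype ≠ ⊥
    rwa [Ne, (Submodule.map_injective_of_injective
      U.toSubmodule.subtype_injective).eq_iff' (Submodule.map_bot _)], rfl⟩
  rw [← hn, e] at h1
  exact Submodule.eq_top_of_finrank_eq (le_antisymm (Submodule.finrank_le S) h1)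

theorem HaveCommonIrreducibleFactor.of_injective {V : Type} [AddCommGroup V] [Module k V]
    [FiniteDimensional k V] [Nontrivial V] {ρ : Representation k G V}
    (φ : ρ.IntertwiningMap σ) (hφ : Function.Injective φ) :
    HaveCommonIrreducibleFactor ρ σ := by
  obtain ⟨U, hU⟩ := exists_irreducible_subrepresentation ρ
  let i : U.toRepresentation.IntertwiningMap ρ :=
    LinearMap.intertwiningMap_of_isIntertwiningMap _ _ _ U.subtype_intertwining
  have hi : Function.Injective i := U.toSubmodule.subtype_injective
  exact ⟨_, _, _, _, hU, .of_injective i hi, .of_injective (φ.comp i) (hφ.comp hi)⟩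

end General

/-! ### Common factors forced by relations between χ₁ and χ₂. -/

section CharacterFactors

variable {k G V : Type} [Field k] [Group G] [AddCommGroup V] [Module k V]
  {ρ : Representation k G V} {χ₁ χ₂ : G →* kˣ}

theorem characterRep_one_apply (g : G) (a : k) : characterRep (1 : G →* kˣ) g a = a := by
  simp [characterRep_apply]

/-- The trivial representation embeds into the endomorphisms as the scalars. -/
theorem isSubquotientRep_one_linHom [Nontrivial V] :
    IsSubquotientRep (characterRep (1 : G →* kˣ)) (linHom ρ ρ) := by
  refine .of_injective (LinearMap.intertwiningMap_of_isIntertwiningMap _ _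
    (LinearMap.toSpanSingleton k (V →ₗ[k] V) LinearMap.id) ?_) ?_
  · intro g a
    ext v
    simp [characterRep_one_apply]
  · intro a b hab
    obtain ⟨v, hv⟩ := exists_ne (0 : V)
    exact smul_left_injective k hv (LinearMap.congr_fun hab v)

theorem HaveCommonIrreducibleFactor.of_fixed_vector {v : V} (hv : v ≠ 0)
    (h : ∀ g, ρ g v = v) : HaveCommonIrreducibleFactor ρ (linHom ρ ρ) := by
  have : Nontrivial V := ⟨v, 0, hv⟩
  refine .of_character 1 (.of_injective (LinearMap.intertwiningMap_of_isIntertwiningMap _ _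
    (LinearMap.toSpanSingleton k V v) ?_) ?_) isSubquotientRep_one_linHom
  · intro g a
    simp [characterRep_one_apply, h]
  · exact smul_left_injective k hv

theorem IsExtensionOfCharacters.haveCommonIrreducibleFactor
    (h : IsExtensionOfCharacters ρ χ₁ χ₂)
    (hχ : χ₁ = 1 ∨ χ₁ = χ₂ ^ 2 ∨ χ₂ = 1 ∨ χ₂ = χ₁ ^ 2) :
    HaveCommonIrreducibleFactor ρ (linHom ρ ρ) := by
  obtain ⟨i, q, hi, hiq, hq⟩ := h
  have : Nontrivial V := hi.nontrivial
  have h1 : IsSubquotientRep (characterRep χ₁) ρ := .of_injective i hi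
  have h2 : IsSubquotientRep (characterRep χ₂) ρ := .of_surjective q hq
  have hie : ∀ g, ρ g (i 1) = (χ₁ g : k) • i 1 := fun g => by
    rw [← i.isIntertwining, ← map_smul, characterRep_apply, smul_eq_mul]
  have hqe : ∀ g v, q (ρ g v) = (χ₂ g : k) * q v := fun g v => by
    rw [q.isIntertwining, characterRep_apply]
  have hi1 : i 1 ≠ 0 := fun h => one_ne_zero (hi (h.trans (map_zero i).symm))
  obtain rfl | h | rfl | h := hχ
  · exact .of_character 1 h1 isSubquotientRep_one_linHom
  · have hc : χ₂ = χ₁ * χ₂⁻¹ := by rw [h, pow_two, mul_inv_cancel_right]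
    -- The embedding of Hom(χ₂, χ₁) = χ₂ sends `a` to the endomorphism `v ↦ q v • i a`.
    refine .of_character χ₂ h2 (.of_injective (LinearMap.intertwiningMap_of_isIntertwiningMap _ _
      ((LinearMap.smulRightₗ (R := k) q.toLinearMap).comp i.toLinearMap) ?_) ?_)
    · intro g a
      have ha : ∀ a : k, i a = a • i 1 := fun a => by rw [← map_smul, smul_eq_mul, mul_one]
      ext v
      change q v • i (characterRep χ₂ g a) = ρ g (q (ρ g⁻¹ v) • i a)
      have hcg : (χ₂ g : k) = χ₁ g * (χ₂ g : k)⁻¹ := by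
        rw [← Units.val_inv_eq_inv_val, ← Units.val_mul, ← MonoidHom.inv_apply,
          ← MonoidHom.mul_apply, ← hc]
      rw [ha, ha a, hqe, characterRep_apply, hcg]
      simp only [map_smul, hie, smul_smul, map_inv, Units.val_inv_eq_inv_val]
      congr 1
      ring
    · intro a b hab
      obtain ⟨v, hv⟩ := hq 1
      have : q v • i a = q v • i b := LinearMap.congr_fun hab v
      rw [hv, one_smul, one_smul] at this
      exact hi this
  · exact .of_character 1 h2 isSubquotientRep_one_linHom
  · have hc : χ₁ = χ₂ * χ₁⁻¹ := by rw [h, pow_two, mul_inv_cancel_right]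
    -- The projection onto Hom(χ₁, χ₂) = χ₁ sends `f` to `q (f (i 1))`.
    refine .of_character χ₁ h1 (.of_surjective (LinearMap.intertwiningMap_of_isIntertwiningMap _ _
      (q.toLinearMap.comp (LinearMap.applyₗ (i 1))) ?_) ?_)
    · intro g f
      change q (ρ g (f (ρ g⁻¹ (i 1)))) = characterRep χ₁ g (q (f (i 1)))
      have hcg : (χ₁ g : k) = χ₂ g * (χ₁ g : k)⁻¹ := by
        rw [← Units.val_inv_eq_inv_val, ← Units.val_mul, ← MonoidHom.inv_apply,
          ← MonoidHom.mul_apply, ← hc]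
      rw [hqe, characterRep_apply, hie, map_smul, map_smul, smul_eq_mul, map_inv,
        Units.val_inv_eq_inv_val, ← mul_assoc, ← hcg]
    · intro a
      obtain ⟨v, rfl⟩ := hq a
      obtain ⟨f, hf⟩ := Module.Projective.exists_dual_ne_zero k hi1
      refine ⟨(f (i 1))⁻¹ • f.smulRight v, ?_⟩
      change q ((f (i 1))⁻¹ • f (i 1) • v) = q v
      rw [inv_smul_smul₀ hf]

end CharacterFactors

/-! ### Subgroups of S₃ have a common factor. -/

section SymmetricGroup

variable {k G V : Type} [Field k] [Group G] [AddCommGroup V] [Module k V]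
  {ρ : Representation k G V}

/-- Take `u` fixed by `s`. Unless some nonzero vector is fixed by both `r` and `s`, the vectors u,
ru, r²u span V with sum zero, and they are permuted exactly as the reflections s, rsr⁻¹, r²sr⁻² are
under conjugation. The argument holds in every characteristic. -/
theorem HaveCommonIrreducibleFactor.of_mem_closure_of_order_three (hV : Module.finrank k V = 2)
    {r s : Module.End k V} (hr : r * r * r = 1) (hr1 : r ≠ 1) (hs : s * s = 1)
    (hsr : s * r = r * r * s) (hG : ∀ g, ρ g ∈ Submonoid.closure {r, s}) :
    HaveCommonIrreducibleFactor ρ (linHom ρ ρ) := by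
  have : FiniteDimensional k V := .of_finrank_pos (by omega)
  have : Nontrivial V := Module.nontrivial_of_finrank_pos (R := k) (by omega)
  have hr' : ∀ v, r (r (r v)) = v := fun v => LinearMap.congr_fun hr v
  have hs' : ∀ v, s (s v) = v := fun v => LinearMap.congr_fun hs v
  have hsr' : ∀ v, s (r v) = r (r (s v)) := fun v => LinearMap.congr_fun hsr v
  have fixed : ∀ v, v ≠ 0 → r v = v → s v = v →
      HaveCommonIrreducibleFactor ρ (linHom ρ ρ) := by
    intro v hv h1 h2
    refine .of_fixed_vector hv fun g => ?_
    have : Submonoid.closure {r, s} ≤ (MulAction.stabilizerSubmonoid (Module.End k V) v) := by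
      rw [Submonoid.closure_le]
      rintro x (rfl | rfl)
      exacts [h1, h2]
    exact this (hG g)
  have hsne : s ≠ -1 := by
    rintro rfl
    have h : r = r * r := by simpa using hsr
    rw [← h, ← h] at hr
    exact hr1 hr
  obtain ⟨u, hu, hsu⟩ : ∃ u, u ≠ 0 ∧ s u = u := by
    by_contra! h
    apply hsne
    ext v
    by_contra hv
    refine h (s v + v) (fun h0 => hv ?_) ?_
    · simpa using eq_neg_of_add_eq_zero_left h0
    · rw [map_add, hs', add_comm]
  by_cases hw : u + r u + r (r u) = 0
  swap
  · refine fixed _ hw ?_ ?_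
    · rw [map_add, map_add, hr']; abel
    · simp only [map_add, hsr', hsu, hr']; abel
  by_cases hli : LinearIndependent k ![u, r u]
  swap
  -- If `u` is an eigenvector of `r`, its eigenvalue satisfies l³ = 1 and, by the dihedral relation,
  -- l = l²; hence `u` is fixed.
  · obtain ⟨l, hl⟩ : ∃ l : k, l • u = r u := by
      by_contra! h
      exact hli (LinearIndependent.pair_iff' hu |>.2 h)
    have h3 : l * l * l = 1 := by
      have := hr' u
      rw [← hl, map_smul, map_smul, ← hl, map_smul, ← hl, smul_smul, smul_smul] at this
      exact smul_left_injective k hu (by simpa using this)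
    have h2 : l = l * l := by
      have := hsr' u
      rw [hsu, ← hl, map_smul, map_smul, ← hl, hsu, smul_smul] at this
      exact smul_left_injective k hu this
    have h1 : l = 1 := by rw [← h2, ← h2] at h3; exact h3
    exact fixed u hu (by rw [← hl, h1, one_smul]) hsu
  let b := basisOfLinearIndependentOfCardEqFinrank hli (by simp [hV])
  have hb0 : b 0 = u := by simp [b]
  have hb1 : b 1 = r u := by simp [b]
  have hsum : 1 + r + r * r = 0 := by
    refine b.ext fun i => ?_
    fin_cases i
    · simpa [hb0] using hw
    · change b 1 + r (b 1) + r (r (b 1)) = 0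
      rw [hb1, hr', ← hw]; abel
  -- Here r²s = rsr⁻¹; linearity and 1 + r + r² = 0 give the value rs = r²sr⁻² at r²u.
  let φ : V →ₗ[k] Module.End k V := b.constr k ![s, r * r * s]
  have hφ0 : φ u = s := by rw [← hb0]; simp [φ]
  have hφ1 : φ (r u) = r * r * s := by rw [← hb1]; simp [φ]
  have hφ2 : φ (r (r u)) = r * s := by
    rw [show r (r u) = -(u + r u) from eq_neg_of_add_eq_zero_right hw, map_neg, map_add, hφ0, hφ1]
    have : (1 + r + r * r) * s = 0 := by rw [hsum, zero_mul]
    rw [neg_eq_iff_add_eq_zero, ← this]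
    noncomm_ring
  have hφr : ∀ v, φ (r v) * r = r * φ v := by
    have : (LinearMap.mulRight k r ∘ₗ φ ∘ₗ r : V →ₗ[k] Module.End k V) =
        LinearMap.mulLeft k r ∘ₗ φ := by
      refine b.ext fun i => ?_
      fin_cases i
      · change φ (r (b 0)) * r = r * φ (b 0)
        rw [hb0, hφ1, hφ0, mul_assoc, hsr]
        calc r * r * (r * r * s) = r * r * r * (r * s) := by noncomm_ring
          _ = r * s := by rw [hr, one_mul]
      · change φ (r (b 1)) * r = r * φ (b 1)
        rw [hb1, hφ1, hφ2, mul_assoc, hsr]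
    exact fun v => LinearMap.congr_fun this v
  have hφs : ∀ v, φ (s v) * s = s * φ v := by
    have : (LinearMap.mulRight k s ∘ₗ φ ∘ₗ s : V →ₗ[k] Module.End k V) =
        LinearMap.mulLeft k s ∘ₗ φ := by
      refine b.ext fun i => ?_
      fin_cases i
      · change φ (s (b 0)) * s = s * φ (b 0)
        rw [hb0, hsu, hφ0]
      · change φ (s (b 1)) * s = s * φ (b 1)
        rw [hb1, hsr', hsu, hφ1, hφ2, mul_assoc, hs]
        calc r * 1 = r * r * r * r * (s * s) := by rw [hr, hs, one_mul]
          _ = r * r * (r * r * s) * s := by noncomm_ring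
          _ = r * r * (s * r) * s := by rw [hsr]
          _ = r * r * s * r * s := by noncomm_ring
          _ = s * r * r * s := by rw [hsr]
          _ = s * (r * r * s) := by noncomm_ring
    exact fun v => LinearMap.congr_fun this v
  have hφg : ∀ a ∈ Submonoid.closure {r, s}, ∀ v, φ (a v) * a = a * φ v := by
    intro a ha
    induction ha using Submonoid.closure_induction with
    | mem x hx =>
      obtain rfl | rfl := hx
      exacts [hφr, hφs]
    | one => simp
    | mul x y _ _ hx hy =>
      intro v
      rw [Module.End.mul_apply, ← mul_assoc, hx, mul_assoc, hy, mul_assoc]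
  refine .of_injective (LinearMap.intertwiningMap_of_isIntertwiningMap _ _ φ ?_) ?_
  · intro g v
    have h := hφg _ (hG g) v
    change _ = ρ g * (φ v * ρ g⁻¹)
    rw [← mul_assoc, ← h, mul_assoc, ← map_mul, mul_inv_cancel, map_one, mul_one]
  · change Function.Injective φ
    rw [injective_iff_map_eq_zero]
    intro v hv
    have hv' := LinearMap.congr_fun hv u
    rw [← b.sum_repr v] at hv' ⊢
    simp only [Fin.sum_univ_two, hb0, hb1, map_add, map_smul, hφ0, hφ1, LinearMap.add_apply,
      LinearMap.smul_apply, Module.End.mul_apply, hsu, LinearMap.zero_apply] at hv' ⊢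
    rw [show r (r u) = -(u + r u) from eq_neg_of_add_eq_zero_right hw] at hv'
    have h2 : (b.repr v 0 - b.repr v 1) • u + (-b.repr v 1) • r u = 0 := by
      rw [← hv']; module
    obtain ⟨h3, h4⟩ := LinearIndependent.pair_iff.1 hli _ _ h2
    rw [neg_eq_zero] at h4
    rw [h4, sub_zero] at h3
    rw [h3, h4]; simp

theorem haveCommonIrreducibleFactor_of_le_symmetricGroup (hV : Module.finrank k V = 2)
    {G H : Subgroup (LinearMap.GeneralLinearGroup k V)} (hGH : G ≤ H)
    (e : H ≃* Equiv.Perm (Fin 3)) :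
    HaveCommonIrreducibleFactor (tautologicalRep G)
      (linHom (tautologicalRep G) (tautologicalRep G)) := by
  let j : Equiv.Perm (Fin 3) →* Module.End k V :=
    ((Units.coeHom _).comp H.subtype).comp e.symm.toMonoidHom
  have hj : Function.Injective j :=
    Units.val_injective.comp (Subtype.val_injective.comp e.symm.injective)
  refine .of_mem_closure_of_order_three hV (r := j (finRotate 3)) (s := j (Equiv.swap 0 1))
    ?_ ?_ ?_ ?_ ?_
  · rw [← map_mul, ← map_mul, ← map_one j]; congr 1; decide
  · rw [← map_one j]; exact hj.ne (by decide)
  · rw [← map_mul, ← map_one j]; congr 1; decide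
  · simp only [← map_mul]; congr 1; decide
  · intro g
    obtain ⟨σ, hσ⟩ := e.symm.surjective ⟨g, hGH g.2⟩
    have hg : tautologicalRep G g = j σ := by
      change ((g : LinearMap.GeneralLinearGroup k V) : Module.End k V) =
        ((e.symm σ : LinearMap.GeneralLinearGroup k V) : Module.End k V)
      rw [hσ]
    have hgen : ∀ σ : Equiv.Perm (Fin 3), σ = 1 ∨ σ = finRotate 3 ∨ σ = finRotate 3 * finRotate 3 ∨
        σ = Equiv.swap 0 1 ∨ σ = finRotate 3 * Equiv.swap 0 1 ∨
        σ = finRotate 3 * finRotate 3 * Equiv.swap 0 1 := by decide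
    have hr : j (finRotate 3) ∈ Submonoid.closure {j (finRotate 3), j (Equiv.swap 0 1)} :=
      Submonoid.subset_closure (by simp)
    have hs : j (Equiv.swap 0 1) ∈ Submonoid.closure {j (finRotate 3), j (Equiv.swap 0 1)} :=
      Submonoid.subset_closure (by simp)
    rw [hg]
    obtain rfl | rfl | rfl | rfl | rfl | rfl := hgen σ <;>
      simp only [map_mul, map_one, one_mem, hr, hs]
    exacts [mul_mem hr hr, mul_mem hr hs, mul_mem (mul_mem hr hr) hs]

end SymmetricGroup

/-! ### Recognising S₃ from three permuted vectors; the prime 2. -/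

section PermutedTriple

variable {k V : Type} [Field k] [AddCommGroup V] [Module k V]

/-- A group of automorphisms of a plane which permutes three vectors with sum zero spanning the
plane is contained in a copy of the symmetric group. -/
theorem exists_le_symmetricGroup_of_permutes (hV : Module.finrank k V = 2)
    (G : Subgroup (LinearMap.GeneralLinearGroup k V)) (v : Fin 3 → V)
    (hli : LinearIndependent k ![v 0, v 1]) (hsum : ∑ i, v i = 0)
    (hG : ∀ g ∈ G, ∀ i, ∃ j, (g : Module.End k V) (v i) = v j) :
    ∃ H : Subgroup (LinearMap.GeneralLinearGroup k V),
      G ≤ H ∧ Nonempty (H ≃* Equiv.Perm (Fin 3)) := by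
  let b := basisOfLinearIndependentOfCardEqFinrank hli (by simp [hV])
  have hb : ∀ i : Fin 2, b i = v i.castSucc := by
    intro i
    fin_cases i <;> simp [b]
  have hv2 : v 2 = -(v 0 + v 1) := by
    rw [Fin.sum_univ_three] at hsum
    exact eq_neg_of_add_eq_zero_right hsum
  have hinj : Function.Injective v := by
    have h01 : ∀ s t : k, s • v 0 + t • v 1 = 0 → s = 0 ∧ t = 0 := LinearIndependent.pair_iff.1 hli
    have a01 : v 0 ≠ v 1 := fun h => one_ne_zero (h01 1 (-1) (by rw [h]; module)).1
    -- The relation is 2v₀ + v₁ = 0; the coefficient 1 is the one used, because 2 may vanish in `k`.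
    have a02 : v 0 ≠ v 2 := fun h => one_ne_zero (h01 2 1 (by
      rw [hv2] at h; linear_combination (norm := module) (1 : k) • h)).2
    have a12 : v 1 ≠ v 2 := fun h => one_ne_zero (h01 1 2 (by
      rw [hv2] at h; linear_combination (norm := module) (1 : k) • h)).1
    intro i j hij
    fin_cases i <;> fin_cases j <;> first | rfl | exact absurd hij ‹_› | exact absurd hij.symm ‹_›
  let A : Equiv.Perm (Fin 3) → Module.End k V := fun σ => b.constr k fun i => v (σ i.castSucc)
  have hA : ∀ σ i, A σ (v i) = v (σ i) := by
    intro σ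
    have h0 : A σ (v 0) = v (σ 0) := by
      have := b.constr_basis k (fun i => v (σ i.castSucc)) 0
      rwa [hb] at this
    have h1 : A σ (v 1) = v (σ 1) := by
      have := b.constr_basis k (fun i => v (σ i.castSucc)) 1
      rwa [hb] at this
    have h2 : A σ (v 2) = v (σ 2) := by
      have : ∑ i, v (σ i) = 0 := (Equiv.sum_comp σ v).trans hsum
      rw [Fin.sum_univ_three] at this
      rw [hv2, map_neg, map_add, h0, h1]
      exact (eq_neg_of_add_eq_zero_right this).symm
    intro i
    fin_cases i
    exacts [h0, h1, h2]
  have hext : ∀ {f g : Module.End k V}, (∀ i, f (v i) = g (v i)) → f = g := fun h =>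
    b.ext fun i => by rw [hb]; exact h _
  let Φ : Equiv.Perm (Fin 3) →* Module.End k V :=
    { toFun := A
      map_one' := hext fun i => by rw [hA]; rfl
      map_mul' := fun σ τ => hext fun i => by rw [hA, Module.End.mul_apply, hA, hA]; rfl }
  let Ψ : Equiv.Perm (Fin 3) →* LinearMap.GeneralLinearGroup k V := Φ.toHomUnits
  have hΨ : ∀ σ i, (Ψ σ : Module.End k V) (v i) = v (σ i) := hA
  have hΨinj : Function.Injective Ψ := fun σ τ h => Equiv.ext fun i => hinj (by
    rw [← hΨ, ← hΨ, h])
  refine ⟨Ψ.range, fun g hg => ?_, ⟨(MonoidHom.ofInjective hΨinj).symm⟩⟩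
  choose σ hσ using hG g hg
  have hginj : Function.Injective (g : Module.End k V) :=
    (LinearMap.GeneralLinearGroup.toLinearEquiv g).injective
  have hσinj : Function.Injective σ := fun i j hij => hinj (hginj (by rw [hσ, hσ, hij]))
  refine ⟨Equiv.ofBijective σ (Finite.injective_iff_bijective.1 hσinj), Units.ext (hext fun i => ?_)⟩
  rw [hΨ, hσ]
  rfl

/-- A plane over 𝔽₂ has exactly three nonzero vectors, and their sum is zero. -/
theorem two_lt_of_not_le_symmetricGroup (p : ℕ) [Fact p.Prime] {V : Type} [AddCommGroup V]
    [Module (ZMod p) V] (hV : Module.finrank (ZMod p) V = 2)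
    (G : Subgroup (LinearMap.GeneralLinearGroup (ZMod p) V))
    (h : ¬ ∃ H : Subgroup (LinearMap.GeneralLinearGroup (ZMod p) V),
        G ≤ H ∧ Nonempty (H ≃* Equiv.Perm (Fin 3))) : 2 < p := by
  refine lt_of_le_of_ne (Fact.out (p := p.Prime)).two_le ?_
  rintro rfl
  apply h
  have : FiniteDimensional (ZMod 2) V := .of_finrank_pos (by omega)
  let b := Module.finBasisOfFinrankEq (ZMod 2) V hV
  have hli : LinearIndependent (ZMod 2) ![b 0, b 1] := by
    convert b.linearIndependent
    ext i
    fin_cases i <;> rfl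
  refine exists_le_symmetricGroup_of_permutes hV G ![b 0, b 1, -(b 0 + b 1)] hli
    (by simp [Fin.sum_univ_three]) fun g _ i => ?_
  have key : ∀ w : V, w ≠ 0 → ∃ j, w = ![b 0, b 1, -(b 0 + b 1)] j := by
    intro w hw
    have hw' := b.sum_repr w
    rw [Fin.sum_univ_two] at hw'
    generalize b.repr w 0 = x at hw'
    generalize b.repr w 1 = y at hw'
    have hx : ∀ z : ZMod 2, z = 0 ∨ z = 1 := fun z => by
      fin_cases z
      exacts [.inl rfl, .inr rfl]
    have hneg : ∀ v : V, -v = v := fun v => by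
      rw [← neg_one_smul (ZMod 2) v, show (-1 : ZMod 2) = 1 from rfl, one_smul]
    obtain rfl | rfl := hx x <;> obtain rfl | rfl := hx y
    · exact absurd (by simpa using hw'.symm) hw
    · exact ⟨1, by simpa using hw'.symm⟩
    · exact ⟨0, by simpa using hw'.symm⟩
    · exact ⟨2, by simpa [hneg] using hw'.symm⟩
  refine key _ ?_
  have hb0 := b.ne_zero 0
  have hb1 := b.ne_zero 1
  have hb2 : -(b 0 + b 1) ≠ 0 := by
    rw [neg_ne_zero]
    intro h0
    exact one_ne_zero (LinearIndependent.pair_iff.1 hli 1 1 (by simpa using h0)).1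
  refine (LinearMap.GeneralLinearGroup.toLinearEquiv g).map_ne_zero_iff.2 ?_
  fin_cases i
  exacts [hb0, hb1, hb2]

end PermutedTriple

/-! ### Vanishing of H¹ through explicit cocycles. -/

section Cocycles

variable {k G V : Type} [Field k] [Group G] [AddCommGroup V] [Module k V]

theorem subsingleton_H1_of_forall_cocycle (ρ : Representation k G V)
    (h : ∀ c : G → V, (∀ g h, c (g * h) = ρ g (c h) + c g) → ∃ v, ∀ g, c g = ρ g v - v) :
    Subsingleton (groupCohomology.H1 (Rep.of ρ)) := by
  refine subsingleton_of_forall_eq 0 fun x => ?_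
  induction x using groupCohomology.H1_induction_on with
  | h c =>
    rw [groupCohomology.H1π_eq_zero_iff]
    obtain ⟨v, hv⟩ := h c ((groupCohomology.mem_cocycles₁_iff c).1 c.2)
    exact ⟨v, funext fun g => (hv g).symm⟩

/-- A group acting through a character `χ` has no first cohomology if modulo a normal subgroup `P`
it is abelian and acts on `P`, as on `χ₁ χ₂⁻¹`, differently from `χ`. -/
theorem exists_eq_sub_of_cocycle_character {χ χ₁ χ₂ : G →* kˣ} (hχ : χ ≠ 1)
    (hne : χ * χ₂ ≠ χ₁) (hker : ∀ x, χ₁ x = 1 → χ₂ x = 1 → χ x = 1)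
    (hP : ∀ x, χ₁ x = 1 → χ₂ x = 1 → ∀ g, ∃ n : ℕ,
      (n : k) * χ₂ g = χ₁ g ∧ g * x = x ^ n * g)
    {c : G → k} (hc : ∀ g h, c (g * h) = χ g * c h + c g) :
    ∃ a, ∀ g, c g = χ g * a - a := by
  have hc1 : c 1 = 0 := by simpa using hc 1 1
  have hP0 : ∀ x, χ₁ x = 1 → χ₂ x = 1 → c x = 0 := by
    intro x h1 h2
    have hχx := hker x h1 h2
    -- χ is trivial on P, so `c` restricts to a homomorphism there. Evaluating `c` on g x = xⁿ g in
    -- two ways gives (χ(g) - n) c(x) = 0, and some g has χ(g) ≠ n in `k`.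
    have hpow : ∀ n : ℕ, c (x ^ n) = n * c x := by
      intro n
      induction n with
      | zero => simp [hc1]
      | succ n ih => rw [pow_succ', hc, hχx, ih]; push_cast; ring
    obtain ⟨g, hg⟩ : ∃ g, (χ * χ₂) g ≠ χ₁ g := by
      by_contra! h
      exact hne (MonoidHom.ext h)
    obtain ⟨n, hn, hgx⟩ := hP x h1 h2 g
    have h3 := hc g x
    rw [hgx, hc, hpow, map_pow, hχx] at h3
    have h4 : ((χ g : k) * χ₂ g - χ₁ g) * c x = 0 := by
      rw [← hn]
      simp only [one_pow, Units.val_one] at h3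
      linear_combination (-(χ₂ g : k)) * h3
    refine (mul_eq_zero.1 h4).resolve_left fun h5 => hg (Units.ext ?_)
    simpa using sub_eq_zero.1 h5
  have hcomm : ∀ g h, c (g * h) = c (h * g) := by
    intro g h
    -- Commutators lie in P, where both χ - 1 and `c` vanish.
    have e : g * h = (g * h * g⁻¹ * h⁻¹) * (h * g) := by group
    have h1 : χ₁ (g * h * g⁻¹ * h⁻¹) = 1 := by simp [mul_comm (χ₁ g)]
    have h2 : χ₂ (g * h * g⁻¹ * h⁻¹) = 1 := by simp [mul_comm (χ₂ g)]
    rw [e, hc, hker _ h1 h2, hP0 _ h1 h2]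
    simp
  obtain ⟨g₀, hg₀⟩ : ∃ g, χ g ≠ 1 := by
    by_contra! h
    exact hχ (MonoidHom.ext h)
  have hg₀' : (χ g₀ : k) - 1 ≠ 0 := sub_ne_zero.2 fun h => hg₀ (Units.ext h)
  -- The symmetry c(g g₀) = c(g₀ g) expands to (χ(g₀) - 1) c(g) = (χ(g) - 1) c(g₀).
  refine ⟨c g₀ / (χ g₀ - 1), fun g => ?_⟩
  have := hcomm g g₀
  rw [hc, hc] at this
  field_simp
  linear_combination -this

end Cocycles

/-! ### Factors of V and End(V) for an extension of characters. -/

section Extension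

variable {k G V : Type} [Field k] [Group G] [AddCommGroup V] [Module k V]
  {ρ : Representation k G V} {χ₁ χ₂ : G →* kˣ}
  {i : (characterRep χ₁).IntertwiningMap ρ} {q : ρ.IntertwiningMap (characterRep χ₂)}

theorem apply_eq_smul_of_exact (hiq : Function.Exact i q) {v : V} (hv : q v = 0) (g : G) :
    ρ g v = (χ₁ g : k) • v := by
  obtain ⟨a, rfl⟩ := (hiq v).1 hv
  rw [← IntertwiningMap.isIntertwining, ← map_smul]
  rfl

/-- Such an `f` factors through `q`, on whose target `g` acts by χ₂. -/
theorem map_apply_eq_smul_of_exact {M : Type} [AddCommGroup M] [Module k M]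
    (hiq : Function.Exact i q) (f : V →ₗ[k] M) (hf : ∀ a, f (i a) = 0) (g : G) (v : V) :
    f (ρ g v) = (χ₂ g : k) • f v := by
  have h : q (ρ g v - (χ₂ g : k) • v) = 0 := by
    rw [map_sub, map_smul, IntertwiningMap.isIntertwining]
    exact sub_self _
  obtain ⟨a, ha⟩ := (hiq _).1 h
  have := hf a
  rwa [ha, map_sub, map_smul, sub_eq_zero] at this

theorem IsExtensionOfCharacters.not_haveCommonIrreducibleFactor
    (h : IsExtensionOfCharacters ρ χ₁ χ₂) (h1 : χ₁ ≠ 1) (h12 : χ₁ ≠ χ₂ ^ 2) (h2 : χ₂ ≠ 1)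
    (h21 : χ₂ ≠ χ₁ ^ 2) : ¬ HaveCommonIrreducibleFactor ρ (linHom ρ ρ) := by
  obtain ⟨i, q, hi, hiq, hq⟩ := h
  rintro ⟨X, _, _, τ, hτ, hV, hE⟩
  have := hτ.nontrivial
  have hiρ : ∀ g a, ρ g (i a) = (χ₁ g : k) • i a := fun g a =>
    apply_eq_smul_of_exact hiq ((hiq _).2 ⟨a, rfl⟩) g
  have hqρ : ∀ g v, q (ρ g v) = (χ₂ g : k) • q v := fun g v =>
    IntertwiningMap.isIntertwining _ _ q g v
  obtain ⟨m, hm, hτm⟩ := hV.exists_smul_of_filtration hτ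
    (fun n => match n with | 0 => ⊥ | 1 => LinearMap.ker q.toLinearMap | _ => ⊤)
    (fun n => match n with | 0 => χ₁ | _ => χ₂) 2 rfl rfl (by
      intro n hn g v hv
      interval_cases n
      · exact sub_eq_zero.2 (apply_eq_smul_of_exact hiq hv g)
      · change q (ρ g v - (χ₂ g : k) • v) = 0
        rw [map_sub, map_smul, hqρ, sub_self])
  -- With L the image of `i`, this is Hom(V/L, L), and `F₂` below is the stabiliser of L. The group
  -- acts on the three graded pieces by χ₁χ₂⁻¹, 1 (on all of `F₂`/`F₁`) and χ₂χ₁⁻¹.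
  let F₁ : Submodule k (V →ₗ[k] V) :=
    { carrier := {f | (∀ a, f (i a) = 0) ∧ ∀ v, q (f v) = 0}
      zero_mem' := by simp
      add_mem' := fun hf hg => ⟨fun a => by simp [hf.1, hg.1], fun v => by simp [hf.2, hg.2]⟩
      smul_mem' := fun c f hf => ⟨fun a => by simp [hf.1], fun v => by simp [hf.2]⟩ }
  let F₂ : Submodule k (V →ₗ[k] V) :=
    { carrier := {f | ∀ a, q (f (i a)) = 0}
      zero_mem' := by simp
      add_mem' := fun hf hg a => by simp [hf a, hg a]
      smul_mem' := fun c f hf a => by simp [hf a] }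
  obtain ⟨n, hn, hτn⟩ := hE.exists_smul_of_filtration hτ
    (fun n => match n with | 0 => ⊥ | 1 => F₁ | 2 => F₂ | _ => ⊤)
    (fun n => match n with | 0 => χ₁ * χ₂⁻¹ | 1 => 1 | _ => χ₂ * χ₁⁻¹) 3 rfl rfl (by
      intro n hn g f hf
      interval_cases n
      · refine sub_eq_zero.2 (LinearMap.ext fun v => ?_)
        change ρ g (f (ρ g⁻¹ v)) = ((χ₁ * χ₂⁻¹) g : k) • f v
        rw [apply_eq_smul_of_exact hiq (hf.2 _), map_apply_eq_smul_of_exact hiq f hf.1, smul_smul]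
        simp
      · refine ⟨fun a => ?_, fun v => ?_⟩
        · change ρ g (f (ρ g⁻¹ (i a))) - ((1 : kˣ) : k) • f (i a) = 0
          rw [hiρ, map_smul, map_smul, apply_eq_smul_of_exact hiq (hf a), smul_smul]
          simp
        · change q (ρ g (f (ρ g⁻¹ v)) - ((1 : kˣ) : k) • f v) = 0
          have := map_apply_eq_smul_of_exact hiq (q.toLinearMap.comp f) hf g⁻¹ v
          simp only [LinearMap.comp_apply, IntertwiningMap.toLinearMap_apply] at this
          rw [map_sub, hqρ, this, smul_smul]
          simp
      · intro a
        change q (ρ g (f (ρ g⁻¹ (i a))) - ((χ₂ * χ₁⁻¹) g : k) • f (i a)) = 0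
        rw [map_sub, hqρ, hiρ, map_smul, map_smul, map_smul, smul_smul]
        simp)
  obtain ⟨x, hx⟩ := exists_ne (0 : X)
  have huniq : ∀ {χ χ' : G →* kˣ}, (∀ g x, τ g x = (χ g : k) • x) →
      (∀ g x, τ g x = (χ' g : k) • x) → χ = χ' := fun h h' =>
    MonoidHom.ext fun g => Units.ext (smul_left_injective k hx ((h g x).symm.trans (h' g x)))
  have heq := huniq hτm hτn
  -- Two factors of V against three characters in End(V): each of the six equalities reduces to one
  -- of the excluded relations.
  interval_cases m <;> interval_cases n <;> simp only at heq
  · exact h2 ((inv_eq_one (a := χ₂)).1 ((left_eq_mul (a := χ₁) (b := χ₂⁻¹)).1 heq))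
  · exact h1 heq
  · exact h21 ((eq_mul_inv_iff_mul_eq.1 heq).symm.trans (pow_two χ₁).symm)
  · exact h12 ((eq_mul_inv_iff_mul_eq.1 heq).symm.trans (pow_two χ₂).symm)
  · exact h2 heq
  · exact h1 ((inv_eq_one (a := χ₁)).1 ((left_eq_mul (a := χ₂) (b := χ₁⁻¹)).1 heq))

end Extension

/-! ### H¹ of an extension of characters over the prime field. -/

section ExtensionPrimeField

variable {p : ℕ} [Fact p.Prime] {G V : Type} [Group G] [AddCommGroup V] [Module (ZMod p) V]
  {ρ : Representation (ZMod p) G V} {χ₁ χ₂ : G →* (ZMod p)ˣ}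

/-- The image of a cocycle in χ₂ is made a coboundary first; what remains is a cocycle in χ₁. The
conditions needed on the action on P are χ₂² ≠ χ₁ and χ₁χ₂ ≠ χ₁ respectively. -/
theorem IsExtensionOfCharacters.subsingleton_H1 (hρ : Function.Injective ρ)
    (h : IsExtensionOfCharacters ρ χ₁ χ₂) (h1 : χ₁ ≠ 1) (h12 : χ₁ ≠ χ₂ ^ 2) (h2 : χ₂ ≠ 1) :
    Subsingleton (groupCohomology.H1 (Rep.of ρ)) := by
  obtain ⟨i, q, hi, hiq, hq⟩ := h
  have hP : ∀ x, χ₁ x = 1 → χ₂ x = 1 → ∀ g, ∃ n : ℕ,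
      (n : ZMod p) * χ₂ g = χ₁ g ∧ g * x = x ^ n * g := by
    intro x hx1 hx2 g
    let N : V →ₗ[ZMod p] V := ρ x - 1
    have hNi : ∀ a, N (i a) = 0 := fun a => by
      change ρ x (i a) - i a = 0
      rw [apply_eq_smul_of_exact hiq ((hiq _).2 ⟨a, rfl⟩) x, hx1]
      simp
    have hqN : ∀ v, q (N v) = 0 := fun v => by
      change q (ρ x v - v) = 0
      rw [map_sub, IntertwiningMap.isIntertwining, characterRep_apply, hx2]
      simp
    have hxN : ∀ v, ρ x v = v + N v := fun v => (add_sub_cancel v (ρ x v)).symm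
    have hNN : ∀ v, N (N v) = 0 := fun v => by
      obtain ⟨a, ha⟩ := (hiq _).1 (hqN v)
      rw [← ha, hNi]
    have hpow : ∀ n : ℕ, ∀ v, ρ (x ^ n) v = v + (n : ZMod p) • N v := by
      intro n
      induction n with
      | zero => simp
      | succ n ih =>
        intro v
        rw [pow_succ', map_mul, Module.End.mul_apply, ih, map_add, map_smul, hxN, hxN, hNN]
        push_cast
        module
    -- With x = 1 + N and N² = 0, conjugation by g scales N by χ₁(g)χ₂(g)⁻¹. Over 𝔽_p this scalar is
    -- the class of an integer n, and 1 + nN = xⁿ.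
    refine ⟨((χ₁ g : ZMod p) * (χ₂ g : ZMod p)⁻¹).val, ?_, hρ (LinearMap.ext fun v => ?_)⟩
    · rw [ZMod.natCast_zmod_val, inv_mul_cancel_right₀ (Units.ne_zero _)]
    · rw [map_mul, map_mul, Module.End.mul_apply, Module.End.mul_apply, hpow, hxN, map_add,
        apply_eq_smul_of_exact hiq (hqN v), map_apply_eq_smul_of_exact hiq N hNi,
        ZMod.natCast_zmod_val, smul_smul, inv_mul_cancel_right₀ (Units.ne_zero _)]
  refine subsingleton_H1_of_forall_cocycle ρ fun c hc => ?_
  obtain ⟨a, ha⟩ := exists_eq_sub_of_cocycle_character (χ := χ₂) (χ₁ := χ₁) (χ₂ := χ₂) h2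
    (fun h => h12 (h.symm.trans (pow_two χ₂).symm)) (fun _ _ h => h) hP (c := fun g => q (c g)) (fun g h => by
      rw [hc, map_add, IntertwiningMap.isIntertwining, characterRep_apply])
  obtain ⟨w, rfl⟩ := hq a
  have hker : ∀ g, ∃ b, i b = c g - (ρ g w - w) := fun g => (hiq _).1 (by
    rw [map_sub, ha, map_sub, IntertwiningMap.isIntertwining, characterRep_apply, sub_self])
  choose d hd using hker
  obtain ⟨b, hb⟩ := exists_eq_sub_of_cocycle_character (χ := χ₁) (χ₁ := χ₁) (χ₂ := χ₂) h1
    (fun h => h2 ((mul_eq_left (a := χ₁) (b := χ₂)).1 h)) (fun _ h _ => h) hP (c := d) (fun g h => hi (by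
      rw [map_add, ← characterRep_apply, IntertwiningMap.isIntertwining, hd, hd, hd, hc]
      simp only [map_mul, map_sub, Module.End.mul_apply]
      abel))
  refine ⟨w + i b, fun g => ?_⟩
  have := hd g
  rw [hb, ← characterRep_apply, map_sub, IntertwiningMap.isIntertwining] at this
  rw [map_add, ← sub_eq_zero]
  rw [← sub_eq_zero] at this
  rw [← neg_eq_zero, ← this]
  abel

end ExtensionPrimeField

/-! ### Cayley–Hamilton in dimension two and its polarisation. -/

section Plane

variable {k V : Type} [Field k] [AddCommGroup V] [Module k V]

theorem Module.End.mul_self_of_finrank_eq_two (hV : Module.finrank k V = 2) (A : Module.End k V) :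
    A * A = LinearMap.trace k V A • A - LinearMap.det A • (1 : Module.End k V) := by
  have : FiniteDimensional k V := .of_finrank_pos (by omega)
  let b := Module.finBasisOfFinrankEq k V hV
  rw [LinearMap.trace_eq_matrix_trace k b, ← LinearMap.det_toMatrix b]
  apply (LinearMap.toMatrixAlgEquiv b).injective
  simp only [map_mul, map_sub, map_smul, map_one]
  change _ * _ = Matrix.trace (LinearMap.toMatrixAlgEquiv b A) • _ -
    Matrix.det (LinearMap.toMatrixAlgEquiv b A) • _
  generalize LinearMap.toMatrixAlgEquiv b A = M
  ext i j
  fin_cases i <;> fin_cases j <;>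
    simp [Matrix.mul_apply, Fin.sum_univ_two, Matrix.trace_fin_two, Matrix.det_fin_two] <;> ring

theorem Module.End.mul_add_mul_of_finrank_eq_two (hV : Module.finrank k V = 2)
    (A B : Module.End k V) : ∃ c : k,
    A * B + B * A = LinearMap.trace k V A • B + LinearMap.trace k V B • A +
      c • (1 : Module.End k V) := by
  have h := Module.End.mul_self_of_finrank_eq_two hV (A + B)
  rw [add_mul, mul_add, mul_add, Module.End.mul_self_of_finrank_eq_two hV A,
    Module.End.mul_self_of_finrank_eq_two hV B, map_add] at h
  refine ⟨LinearMap.det A + LinearMap.det B - LinearMap.det (A + B), ?_⟩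
  linear_combination (norm := module) (1 : k) • h

end Plane

/-! ### Reducible planes. -/

section Character

variable {k G V : Type} [Field k] [Group G] [AddCommGroup V] [Module k V]
  {ρ : Representation k G V}

/-- A plane representation which is not irreducible is an extension of characters. -/
theorem exists_isExtensionOfCharacters (hV : Module.finrank k V = 2) (hρ : ¬ ρ.IsIrreducible) :
    ∃ χ₁ χ₂ : G →* kˣ, IsExtensionOfCharacters ρ χ₁ χ₂ := by
  have : FiniteDimensional k V := .of_finrank_pos (by omega)
  have : Nontrivial V := Module.nontrivial_of_finrank_pos (R := k) (by omega)
  obtain ⟨L, hL, hbot, htop⟩ : ∃ L : Submodule k V, (∀ g, ∀ v ∈ L, ρ g v ∈ L) ∧ L ≠ ⊥ ∧ L ≠ ⊤ := by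
    by_contra! h
    exact hρ (isIrreducible_of_forall fun U hU => or_iff_not_imp_left.2 (h U hU))
  have h1 := Submodule.one_le_finrank_iff.2 hbot
  have h2 := Submodule.finrank_lt htop
  have h3 := L.finrank_quotient_add_finrank
  let e : k ≃ₗ[k] L := LinearEquiv.ofFinrankEq _ _ (by rw [Module.finrank_self]; omega)
  let e' : (V ⧸ L) ≃ₗ[k] k := LinearEquiv.ofFinrankEq _ _ (by rw [Module.finrank_self]; omega)
  let q : V →ₗ[k] k := e'.toLinearMap ∘ₗ L.mkQ
  have hqL : ∀ v, q v = 0 ↔ v ∈ L := fun v => by simp [q]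
  have hqs : Function.Surjective q := e'.surjective.comp L.mkQ_surjective
  obtain ⟨w, hw⟩ := hqs 1
  have hqρ : ∀ g v, q (ρ g v) = q (ρ g w) * q v := fun g v => by
    have : v - q v • w ∈ L := by simp [← hqL, hw]
    have := (hqL _).2 (hL g _ this)
    rw [map_sub, map_sub, map_smul, map_smul, sub_eq_zero] at this
    rw [this, smul_eq_mul, mul_comm]
  let c : G → k := fun g => e.symm ⟨ρ g (e 1), hL g _ (e 1).2⟩
  have hc : ∀ g a, ρ g (e a) = e (c g * a) := fun g a => by
    have h1 : ρ g (e 1) = e (c g) := by simp [c]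
    rw [← mul_one a, ← smul_eq_mul, map_smul, Submodule.coe_smul, map_smul, h1, smul_eq_mul,
      mul_one, mul_comm, ← smul_eq_mul, map_smul, Submodule.coe_smul]
  let χ₁ : G →* k :=
    { toFun := c
      map_one' := by simp [c]
      map_mul' := fun g h => e.injective (Subtype.ext (by
        have h1 : ρ (g * h) (e 1) = e (c (g * h)) := by rw [hc, mul_one]
        rw [← h1, map_mul, Module.End.mul_apply, hc, hc, mul_one])) }
  let χ₂ : G →* k :=
    { toFun := fun g => q (ρ g w)
      map_one' := by simpa using hw
      map_mul' := fun g h => by rw [map_mul, Module.End.mul_apply, hqρ] }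
  refine ⟨χ₁.toHomUnits, χ₂.toHomUnits, LinearMap.intertwiningMap_of_isIntertwiningMap _ _
    (L.subtype ∘ₗ e.toLinearMap) fun g a => (hc g a).symm,
    LinearMap.intertwiningMap_of_isIntertwiningMap _ _ q hqρ,
    Subtype.val_injective.comp e.injective, fun v => ?_, hqs⟩
  refine (hqL v).trans ⟨fun hv => ?_, ?_⟩
  · obtain ⟨a, ha⟩ := e.surjective ⟨v, hv⟩
    exact ⟨a, congrArg Subtype.val ha⟩
  · rintro ⟨a, rfl⟩
    exact (e a).2

end Character

/-! ### Consequences of -1 in the group, and of a group order invertible in the field. -/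

section Central

variable {k G V : Type} [Field k] [Group G] [AddCommGroup V] [Module k V]
  {ρ : Representation k G V}

/-- `z` acts by -1 on every factor of V and trivially on every factor of End(V). -/
theorem not_haveCommonIrreducibleFactor_of_neg_one (h2 : (2 : k) ≠ 0) {z : G} (hz : ρ z = -1) :
    ¬ HaveCommonIrreducibleFactor ρ (linHom ρ ρ) := by
  rintro ⟨X, _, _, τ, hτ, ⟨U, f, hf⟩, ⟨U', f', hf'⟩⟩
  have := hτ.nontrivial
  obtain ⟨x, hx⟩ := exists_ne (0 : X)
  obtain ⟨u, rfl⟩ := hf x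
  obtain ⟨u', hu'⟩ := hf' (f u)
  have hzi : ρ z⁻¹ = -1 := by
    have : ρ z⁻¹ * ρ z = 1 := by rw [← map_mul, inv_mul_cancel, map_one]
    rw [hz] at this
    simpa [neg_eq_iff_eq_neg] using this
  have h1 : τ z (f u) = -f u := by
    rw [← f.isIntertwining, ← map_neg]
    congr 1
    exact Subtype.ext (LinearMap.congr_fun hz u)
  have h2' : τ z (f u) = f u := by
    rw [← hu', ← f'.isIntertwining]
    congr 1
    refine Subtype.ext (LinearMap.ext fun v => ?_)
    change ρ z ((u' : V →ₗ[k] V) (ρ z⁻¹ v)) = (u' : V →ₗ[k] V) v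
    rw [hz, hzi]
    simp
  rw [h1] at h2'
  have h3 : (2 : k) • f u = 0 := by
    rw [two_smul]
    nth_rw 1 [← h2']
    exact neg_add_cancel _
  exact hx ((smul_eq_zero.1 h3).resolve_left h2)

/-- Faithfulness makes `z` central; expanding c(gz) = c(zg) then gives 2c(g) = c(z) - g c(z). -/
theorem subsingleton_H1_of_neg_one (h2 : (2 : k) ≠ 0) (hρ : Function.Injective ρ) {z : G}
    (hz : ρ z = -1) : Subsingleton (groupCohomology.H1 (Rep.of ρ)) := by
  refine subsingleton_H1_of_forall_cocycle ρ fun c hc => ⟨-((2 : k)⁻¹ • c z), fun g => ?_⟩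
  have hcomm : g * z = z * g := hρ (by rw [map_mul, map_mul, hz]; simp)
  have h := hc g z
  rw [hcomm, hc, hz] at h
  simp only [LinearMap.neg_apply, Module.End.one_apply] at h
  have h' : (2 : k) • c g = c z - ρ g (c z) := by
    linear_combination (norm := module) (-1 : k) • h
  rw [map_neg, map_smul, ← inv_smul_smul₀ h2 (c g), h']
  module

theorem subsingleton_H1_of_card_ne_zero [Fintype G] (hG : (Fintype.card G : k) ≠ 0)
    (ρ : Representation k G V) : Subsingleton (groupCohomology.H1 (Rep.of ρ)) := by
  refine subsingleton_H1_of_forall_cocycle ρ fun c hc =>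
    ⟨-((Fintype.card G : k)⁻¹ • ∑ h, c h), fun g => ?_⟩
  have h : ∑ h, c (g * h) = ∑ h, c h := Equiv.sum_comp (Equiv.mulLeft g) c
  simp_rw [hc, Finset.sum_add_distrib, ← map_sum, Finset.sum_const, Finset.card_univ,
    ← Nat.cast_smul_eq_nsmul k] at h
  rw [map_neg, map_smul, ← inv_smul_smul₀ hG (c g), eq_sub_iff_add_eq'.2 h]
  module

end Central

/-! ### Maschke's theorem and embeddings. -/

section Section

variable {k G V W X : Type} [Field k] [Group G] [AddCommGroup V] [Module k V]
  [AddCommGroup W] [Module k W] [AddCommGroup X] [Module k X]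
  {ρ : Representation k G V} {σ : Representation k G W} {τ : Representation k G X}

/-- Averaging a linear section of a surjective intertwining map over a finite group of order
invertible in `k`. -/
theorem exists_intertwining_section [Fintype G] (hG : (Fintype.card G : k) ≠ 0)
    (f : σ.IntertwiningMap τ) (hf : Function.Surjective f) :
    ∃ s : τ.IntertwiningMap σ, ∀ x, f (s x) = x := by
  obtain ⟨s₀, hs₀⟩ := f.toLinearMap.exists_rightInverse_of_surjective (LinearMap.range_eq_top.2 hf)
  have hs₀' : ∀ x, f (s₀ x) = x := fun x => LinearMap.congr_fun hs₀ x
  refine ⟨LinearMap.intertwiningMap_of_isIntertwiningMap _ _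
    ((Fintype.card G : k)⁻¹ • ∑ g, σ g ∘ₗ s₀ ∘ₗ τ g⁻¹) fun h x => ?_, fun x => ?_⟩
  · simp only [LinearMap.smul_apply, LinearMap.sum_apply, LinearMap.comp_apply, map_smul, map_sum]
    congr 1
    rw [← Equiv.sum_comp (Equiv.mulLeft h)]
    refine Finset.sum_congr rfl fun g _ => ?_
    simp only [Equiv.coe_mulLeft, mul_inv_rev, map_mul, Module.End.mul_apply]
    rw [← Module.End.mul_apply (τ h⁻¹), ← map_mul, inv_mul_cancel, map_one, Module.End.one_apply]
  · change f (((Fintype.card G : k)⁻¹ • ∑ g, σ g ∘ₗ s₀ ∘ₗ τ g⁻¹) x) = x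
    simp only [LinearMap.smul_apply, LinearMap.sum_apply, LinearMap.comp_apply, map_smul, map_sum]
    have : ∀ g, f (σ g (s₀ (τ g⁻¹ x))) = x := fun g => by
      rw [IntertwiningMap.isIntertwining, hs₀', ← Module.End.mul_apply, ← map_mul,
        mul_inv_cancel, map_one, Module.End.one_apply]
    simp_rw [this]
    rw [Finset.sum_const, Finset.card_univ, ← Nat.cast_smul_eq_nsmul k, inv_smul_smul₀ hG]

/-- By irreducibility ρ maps injectively to the common factor, and an equivariant section lifts that
factor into a subrepresentation of σ. -/
theorem HaveCommonIrreducibleFactor.exists_injective [Fintype G] (hG : (Fintype.card G : k) ≠ 0)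
    (hρ : ρ.IsIrreducible) (h : HaveCommonIrreducibleFactor ρ σ) :
    ∃ φ : ρ.IntertwiningMap σ, Function.Injective φ := by
  obtain ⟨X, _, _, τ, hτ, ⟨U, f, hf⟩, ⟨U', f', hf'⟩⟩ := h
  have := hτ.nontrivial
  obtain ⟨x, hx⟩ := exists_ne (0 : X)
  obtain ⟨u, rfl⟩ := hf x
  have hU : U.toSubmodule = ⊤ := by
    refine (hρ.eq_bot_or_eq_top_of_stable U.toSubmodule U.apply_mem_toSubmodule).resolve_left ?_
    intro hb
    have hu := hb.le u.2
    rw [Submodule.mem_bot, ZeroMemClass.coe_eq_zero] at hu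
    rw [hu, map_zero] at hx
    exact hx rfl
  have hmem : ∀ v, v ∈ U.toSubmodule := fun v => hU ▸ trivial
  let j : ρ.IntertwiningMap τ := LinearMap.intertwiningMap_of_isIntertwiningMap _ _
    (f.toLinearMap ∘ₗ LinearMap.id.codRestrict U.toSubmodule hmem) fun g v =>
      f.isIntertwining _ _ g ⟨v, hmem v⟩
  obtain ⟨s, hs⟩ := exists_intertwining_section hG f' hf'
  let i : U'.toRepresentation.IntertwiningMap σ :=
    LinearMap.intertwiningMap_of_isIntertwiningMap _ _ _ U'.subtype_intertwining
  have hj : Function.Injective j := (IsIrreducible.injective_or_eq_zero j).resolve_right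
    fun h0 => hx (congrArg (fun l : ρ.IntertwiningMap τ => l u) h0)
  exact ⟨i.comp (s.comp j), U'.toSubmodule.subtype_injective.comp
    ((Function.LeftInverse.injective hs).comp hj)⟩

end Section

/-! ### Transvections in an irreducible group. -/

section Transvection

variable {p : ℕ} [Fact p.Prime] {G V : Type} [Group G] [AddCommGroup V] [Module (ZMod p) V]
  {ρ : Representation (ZMod p) G V}

/-- In characteristic p, (A - 1)^p = A^p - 1 = 0, so A - 1 has zero trace and determinant;
Cayley–Hamilton does the rest. -/
theorem sub_one_mul_sub_one_of_pow_eq_one (hV : Module.finrank (ZMod p) V = 2)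
    {A : Module.End (ZMod p) V} (hA : A ^ p = 1) :
    (A - 1) * (A - 1) = 0 ∧ LinearMap.trace (ZMod p) V (A - 1) = 0 := by
  have : FiniteDimensional (ZMod p) V := .of_finrank_pos (by omega)
  have : Nontrivial V := Module.nontrivial_of_finrank_pos (R := ZMod p) (by omega)
  have : CharP (Module.End (ZMod p) V) p := charP_of_injective_algebraMap
    (algebraMap (ZMod p) (Module.End (ZMod p) V)).injective p
  have hnil : (A - 1) ^ p = 0 := by
    rw [sub_pow_char_of_commute (p := p) (Commute.one_right A), hA, one_pow, sub_self]
  have htr : LinearMap.trace (ZMod p) V (A - 1) = 0 :=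
    (LinearMap.isNilpotent_trace_of_isNilpotent ⟨p, hnil⟩).eq_zero
  have hdet : LinearMap.det (A - 1) = 0 := by
    have h : LinearMap.det (A - 1) ^ p = 0 := by
      rw [← map_pow, hnil, LinearMap.det_zero, hV]; simp
    exact pow_eq_zero_iff (Fact.out (p := p.Prime)).ne_zero |>.1 h
  refine ⟨?_, htr⟩
  rw [Module.End.mul_self_of_finrank_eq_two hV, htr, hdet]
  simp

/-- An irreducible group of automorphisms of a plane over `𝔽_p` which contains a transvection
contains `-1`. -/
theorem exists_eq_neg_one_of_pow_eq_one (hV : Module.finrank (ZMod p) V = 2)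
    (hρ : ρ.IsIrreducible) {x : G} (hx : ρ x ≠ 1) (hxp : x ^ p = 1) : ∃ z, ρ z = -1 := by
  have : FiniteDimensional (ZMod p) V := .of_finrank_pos (by omega)
  obtain ⟨hNN, htr⟩ := sub_one_mul_sub_one_of_pow_eq_one hV (A := ρ x) (by rw [← map_pow, hxp, map_one])
  obtain ⟨N, hN⟩ : ∃ N, N = ρ x - 1 := ⟨_, rfl⟩
  rw [← hN] at hNN htr
  have hN0 : N ≠ 0 := by rw [hN]; exact sub_ne_zero.2 hx
  have hNN' : ∀ v, N (N v) = 0 := fun v => LinearMap.congr_fun hNN v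
  have hxN : ρ x = 1 + N := by rw [hN]; abel
  have hpow : ∀ n : ℕ, ρ (x ^ n) = 1 + (n : ZMod p) • N := by
    intro n
    induction n with
    | zero => simp
    | succ n ih =>
      have : (1 + N) * (1 + (n : ZMod p) • N) = 1 + N + (n : ZMod p) • N + (n : ZMod p) • (N * N) := by
        rw [add_mul, one_mul, mul_add, mul_one, mul_smul_comm]
        abel
      rw [pow_succ', map_mul, ih, hxN, this, hNN]
      push_cast
      module
  -- By irreducibility the line `ker N` is moved by some `g`; the conjugate M = gNg⁻¹ then has a
  -- different kernel.
  obtain ⟨g, v₀, hv₀, hg⟩ : ∃ g v, N v = 0 ∧ N (ρ g v) ≠ 0 := by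
    by_contra! h
    obtain hb | ht := hρ.eq_bot_or_eq_top_of_stable (LinearMap.ker N) fun g v hv => h g v hv
    · apply hN0
      ext v
      exact (LinearMap.ker_eq_bot'.1 hb _ (hNN' v)).trans rfl
    · exact hN0 (LinearMap.ker_eq_top.1 ht)
  have hgi : ρ g⁻¹ * ρ g = 1 := by rw [← map_mul, inv_mul_cancel, map_one]
  have hgi' : ρ g * ρ g⁻¹ = 1 := by rw [← map_mul, mul_inv_cancel, map_one]
  obtain ⟨M, hM⟩ : ∃ M, M = ρ g * N * ρ g⁻¹ := ⟨_, rfl⟩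
  have hMM : M * M = 0 := by
    calc M * M = ρ g * N * (ρ g⁻¹ * ρ g) * N * ρ g⁻¹ := by rw [hM]; noncomm_ring
      _ = ρ g * (N * N) * ρ g⁻¹ := by rw [hgi]; noncomm_ring
      _ = 0 := by rw [hNN]; simp
  have hMtr : LinearMap.trace _ _ M = 0 := by
    rw [hM, LinearMap.trace_mul_comm, ← mul_assoc, hgi, one_mul, htr]
  obtain ⟨c, hc⟩ := Module.End.mul_add_mul_of_finrank_eq_two hV N M
  rw [htr, hMtr, zero_smul, zero_smul, zero_add, zero_add] at hc
  -- If NM + MN = 0, then M kills the basis gv₀, N(gv₀).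
  have hc0 : c ≠ 0 := by
    rintro rfl
    rw [zero_smul] at hc
    have hMw : M (ρ g v₀) = 0 := by
      have h1 : ρ g⁻¹ (ρ g v₀) = v₀ := LinearMap.congr_fun hgi v₀
      rw [hM, Module.End.mul_apply, Module.End.mul_apply, h1, hv₀, map_zero]
    have hMNw : M (N (ρ g v₀)) = 0 := by
      have := LinearMap.congr_fun hc (ρ g v₀)
      simpa [hMw] using this
    have hli : LinearIndependent (ZMod p) ![ρ g v₀, N (ρ g v₀)] := by
      rw [LinearIndependent.pair_iff]
      intro s t hst
      have h1 := congrArg N hst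
      rw [map_add, map_smul, map_smul, hNN', smul_zero, add_zero, map_zero] at h1
      have hs := (smul_eq_zero.1 h1).resolve_right hg
      rw [hs, zero_smul, zero_add] at hst
      exact ⟨hs, (smul_eq_zero.1 hst).resolve_right hg⟩
    let b := basisOfLinearIndependentOfCardEqFinrank hli (by simp [hV])
    have hM0 : M = 0 := by
      refine b.ext fun i => ?_
      fin_cases i
      · simpa [b] using hMw
      · simpa [b] using hMNw
    apply hN0
    calc N = (ρ g⁻¹ * ρ g) * N * (ρ g⁻¹ * ρ g) := by rw [hgi]; simp
      _ = ρ g⁻¹ * (ρ g * N * ρ g⁻¹) * ρ g := by noncomm_ring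
      _ = 0 := by rw [← hM, hM0]; simp
  obtain ⟨y, K, hy, hKK, hK⟩ : ∃ (y : G) (K : Module.End (ZMod p) V), ρ y = 1 + K ∧ K * K = 0 ∧
      N * K + K * N = -1 := by
    -- A power of the conjugate transvection rescales M so that the anticommutator becomes -1. Then
    -- xyx = N + K, the analogue of the Weyl element of SL₂, has square -1.
    refine ⟨g * x ^ (-c⁻¹).val * g⁻¹, (-c⁻¹) • M, ?_, ?_, ?_⟩
    · rw [map_mul, map_mul, hpow, ZMod.natCast_zmod_val, hM, mul_add, add_mul, mul_one, hgi',
        mul_smul_comm, smul_mul_assoc]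
    · rw [smul_mul_smul_comm, hMM, smul_zero]
    · rw [mul_smul_comm, smul_mul_assoc, ← smul_add, hc, smul_smul, neg_mul,
        inv_mul_cancel₀ hc0, neg_one_smul]
  have hNKN : N * K * N = -N := by
    rw [eq_sub_of_add_eq hK, sub_mul, mul_assoc K, hNN]
    simp
  have hw : ρ (x * y * x) = N + K := by
    rw [map_mul, map_mul, hxN, hy]
    calc (1 + N) * (1 + K) * (1 + N) = 1 + N + N + K + (N * K + K * N) + N * N + N * K * N := by
          noncomm_ring
      _ = N + K := by rw [hK, hNN, hNKN]; abel
  refine ⟨x * y * x * (x * y * x), ?_⟩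
  rw [map_mul, hw]
  calc (N + K) * (N + K) = N * N + K * K + (N * K + K * N) := by noncomm_ring
    _ = -1 := by rw [hNN, hKK, hK]; simp

end Transvection

/-! ### Equivariant embeddings of V in End(V). -/

section EquivariantEndomorphisms

variable {k G V : Type} [Field k] [Group G] [AddCommGroup V] [Module k V]
  {ρ : Representation k G V}

/-- The common kernel of all `φ v` is stable and contains all their images; whether it is zero or
everything, φ vanishes. -/
theorem Representation.IsIrreducible.eq_zero_of_forall_mul_eq_zero (hρ : ρ.IsIrreducible)
    {φ : V →ₗ[k] Module.End k V} (hφ : ∀ g v, φ (ρ g v) * ρ g = ρ g * φ v)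
    (h : ∀ v w, φ v * φ w = 0) : φ = 0 := by
  let K : Submodule k V := ⨅ v, LinearMap.ker (φ v)
  have hmem : ∀ x, x ∈ K ↔ ∀ v, φ v x = 0 := fun x => by simp [K]
  have hgi : ∀ g v, ρ g (ρ g⁻¹ v) = v := fun g v => by
    rw [← Module.End.mul_apply, ← map_mul, mul_inv_cancel, map_one, Module.End.one_apply]
  obtain hb | ht := hρ.eq_bot_or_eq_top_of_stable K fun g x hx => (hmem _).2 fun v => by
    have := LinearMap.congr_fun (hφ g (ρ g⁻¹ v)) x
    rw [hgi, Module.End.mul_apply, Module.End.mul_apply, (hmem x).1 hx, map_zero] at this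
    exact this
  · ext v x
    have : φ v x ∈ K := (hmem _).2 fun w => LinearMap.congr_fun (h w v) x
    rw [hb] at this
    exact this
  · ext v x
    exact (hmem x).1 (ht ▸ Submodule.mem_top) v

/-- The trace of φ is an invariant functional, so its kernel is stable; it cannot be injective on a
plane. -/
theorem Representation.IsIrreducible.trace_eq_zero (hV : Module.finrank k V = 2)
    (hρ : ρ.IsIrreducible) {φ : V →ₗ[k] Module.End k V}
    (hφ : ∀ g v, φ (ρ g v) * ρ g = ρ g * φ v) (v : V) : LinearMap.trace k V (φ v) = 0 := by
  have : FiniteDimensional k V := .of_finrank_pos (by omega)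
  let l : V →ₗ[k] k := LinearMap.trace k V ∘ₗ φ
  have hl : ∀ g v, l (ρ g v) = l v := fun g v => by
    have hgi : ρ g * ρ g⁻¹ = 1 := by rw [← map_mul, mul_inv_cancel, map_one]
    have hgi' : ρ g⁻¹ * ρ g = 1 := by rw [← map_mul, inv_mul_cancel, map_one]
    have : φ (ρ g v) = ρ g * φ v * ρ g⁻¹ := by rw [← hφ, mul_assoc, hgi, mul_one]
    change LinearMap.trace k V (φ (ρ g v)) = LinearMap.trace k V (φ v)
    rw [this, LinearMap.trace_mul_comm, ← mul_assoc, hgi', one_mul]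
  obtain hb | ht := hρ.eq_bot_or_eq_top_of_stable (LinearMap.ker l) fun g v hv =>
    (hl g v).trans hv
  · have := LinearMap.finrank_le_finrank_of_injective (LinearMap.ker_eq_bot.1 hb)
    rw [hV, Module.finrank_self] at this
    omega
  · exact LinearMap.congr_fun (LinearMap.ker_eq_top.1 ht) v

/-- An equivariant embedding of an irreducible plane representation into its endomorphisms
determines a regular element `T` on which the group acts through the determinant. -/
theorem exists_semi_invariant (h2 : (2 : k) ≠ 0) (hV : Module.finrank k V = 2)
    (hρ : ρ.IsIrreducible) {φ : V →ₗ[k] Module.End k V} (hφi : Function.Injective φ)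
    (hφ : ∀ g v, φ (ρ g v) * ρ g = ρ g * φ v) :
    ∃ (T : Module.End k V) (t : k), t ≠ 0 ∧ LinearMap.trace k V T = 0 ∧ T * T = t • 1 ∧
      (∀ v, φ v * T = -(T * φ v)) ∧ (∀ g, ρ g * T = LinearMap.det (ρ g) • (T * ρ g)) ∧
      ∀ D : Module.End k V, (∀ v, D * φ v = 0) → D = 0 := by
  have : FiniteDimensional k V := .of_finrank_pos (by omega)
  have : Nontrivial V := Module.nontrivial_of_finrank_pos (R := k) (by omega)
  let b := Module.finBasisOfFinrankEq k V hV
  have hsq : ∀ {A : Module.End k V}, LinearMap.trace k V A = 0 →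
      A * A = (-LinearMap.det A) • (1 : Module.End k V) := fun {A} hA => by
    rw [Module.End.mul_self_of_finrank_eq_two hV, hA]
    module
  obtain ⟨A, hA⟩ : ∃ A, A = φ (b 0) := ⟨_, rfl⟩
  obtain ⟨B, hB⟩ : ∃ B, B = φ (b 1) := ⟨_, rfl⟩
  have htrA : LinearMap.trace k V A = 0 := hA ▸ hρ.trace_eq_zero hV hφ _
  have htrB : LinearMap.trace k V B = 0 := hB ▸ hρ.trace_eq_zero hV hφ _
  obtain ⟨dA, hdA⟩ : ∃ d, A * A = d • (1 : Module.End k V) := ⟨_, hsq htrA⟩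
  obtain ⟨dB, hdB⟩ : ∃ d, B * B = d • (1 : Module.End k V) := ⟨_, hsq htrB⟩
  have hφv : ∀ v, φ v = b.repr v 0 • A + b.repr v 1 • B := fun v => by
    conv_lhs => rw [← b.sum_repr v, Fin.sum_univ_two, map_add, map_smul, map_smul, ← hA, ← hB]
  have hind : ∀ x y : k, x • A + y • B = 0 → x = 0 ∧ y = 0 := fun x y h => by
    have h' : φ (x • b 0 + y • b 1) = 0 := by rw [map_add, map_smul, map_smul, ← hA, ← hB, h]
    have h'' := (map_eq_zero_iff φ hφi).1 h'
    have h3 := Fintype.linearIndependent_iff.1 b.linearIndependent ![x, y]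
      (by simpa [Fin.sum_univ_two] using h'')
    exact ⟨h3 0, h3 1⟩
  obtain ⟨T, hT⟩ : ∃ T, T = A * B - B * A := ⟨_, rfl⟩
  have htrT : LinearMap.trace k V T = 0 := by
    rw [hT, map_sub, LinearMap.trace_mul_comm, sub_self]
  -- If A and B commute, 2AB is a scalar c; multiplying by A and by B and using independence makes
  -- A², B² and AB all zero, so that all products of values of φ vanish.
  have hT0 : T ≠ 0 := by
    intro h0
    rw [hT, sub_eq_zero] at h0
    obtain ⟨c, hc⟩ := Module.End.mul_add_mul_of_finrank_eq_two hV A B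
    rw [htrA, htrB, zero_smul, zero_smul, zero_add, zero_add, ← h0, ← two_smul k] at hc
    have e1 : (2 * dA) • B = c • A := by
      have : A * ((2 : k) • (A * B)) = A * (c • (1 : Module.End k V)) := by rw [hc]
      rw [mul_smul_comm, ← mul_assoc, hdA, smul_mul_assoc, one_mul, mul_smul_comm, mul_one,
        smul_smul] at this
      exact this
    have e2 : (2 * dB) • A = c • B := by
      have : B * ((2 : k) • (A * B)) = B * (c • (1 : Module.End k V)) := by rw [hc]
      rw [mul_smul_comm, h0, ← mul_assoc, hdB, smul_mul_assoc, one_mul, mul_smul_comm, mul_one,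
        smul_smul] at this
      exact this
    obtain ⟨hc0, hdA0⟩ := hind (-c) (2 * dA) (by rw [e1]; module)
    obtain ⟨hdB0, -⟩ := hind (2 * dB) (-c) (by rw [e2]; module)
    have hdA0 := (mul_eq_zero.1 hdA0).resolve_left h2
    have hdB0 := (mul_eq_zero.1 hdB0).resolve_left h2
    rw [neg_eq_zero] at hc0
    rw [hc0, zero_smul] at hc
    have hAB : A * B = 0 := (smul_eq_zero.1 hc).resolve_left h2
    have hBA : B * A = 0 := h0 ▸ hAB
    rw [hdA0, zero_smul] at hdA
    rw [hdB0, zero_smul] at hdB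
    have hφ0 := hρ.eq_zero_of_forall_mul_eq_zero hφ fun v w => by
      rw [hφv v, hφv w]
      simp only [add_mul, mul_add, smul_mul_smul_comm, hdA, hdB, hAB, hBA, smul_zero, add_zero]
    obtain ⟨v, hv⟩ := exists_ne (0 : V)
    exact hv (hφi (by rw [hφ0]; rfl))
  have hφT : ∀ v, φ v * T = -(T * φ v) := by
    have hAT : A * T = -(T * A) := by
      rw [eq_neg_iff_add_eq_zero, hT]
      calc A * (A * B - B * A) + (A * B - B * A) * A = A * A * B - B * (A * A) := by noncomm_ring
        _ = 0 := by rw [hdA]; simp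
    have hBT : B * T = -(T * B) := by
      rw [eq_neg_iff_add_eq_zero, hT]
      calc B * (A * B - B * A) + (A * B - B * A) * B = A * (B * B) - B * B * A := by noncomm_ring
        _ = 0 := by rw [hdB]; simp
    intro v
    rw [hφv, add_mul, mul_add, smul_mul_assoc, smul_mul_assoc, mul_smul_comm, mul_smul_comm, hAT,
      hBT]
    module
  -- The commutator is alternating in its two arguments, so replacing the basis by its image under
  -- `g` multiplies it by det g.
  have hgT : ∀ g, ρ g * T = LinearMap.det (ρ g) • (T * ρ g) := by
    intro g
    have hcol : ∀ j, ρ g (b j) = LinearMap.toMatrix b b (ρ g) 0 j • b 0 +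
        LinearMap.toMatrix b b (ρ g) 1 j • b 1 := fun j => by
      simp only [LinearMap.toMatrix_apply]
      rw [← Fin.sum_univ_two (fun i => b.repr (ρ g (b j)) i • b i), b.sum_repr]
    rw [← LinearMap.det_toMatrix b, Matrix.det_fin_two]
    have h0 := hφ g (b 0)
    have h1 := hφ g (b 1)
    have h01 : ρ g * T = (φ (ρ g (b 0)) * φ (ρ g (b 1)) - φ (ρ g (b 1)) * φ (ρ g (b 0))) * ρ g := by
      rw [sub_mul, mul_assoc, h1, ← mul_assoc, h0, mul_assoc (φ (ρ g (b 1))), h0, ← mul_assoc, h1,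
        hT, hA, hB]
      noncomm_ring
    rw [h01, hcol, hcol, map_add, map_add, map_smul, map_smul, map_smul, map_smul, ← hA, ← hB,
      ← smul_mul_assoc]
    congr 1
    rw [hT]
    simp only [add_mul, mul_add, smul_mul_smul_comm]
    module
  have ht0 : -LinearMap.det T ≠ 0 := by
    intro h0
    have hTT := hsq htrT
    rw [h0, zero_smul] at hTT
    obtain hb | ht := hρ.eq_bot_or_eq_top_of_stable (LinearMap.ker T) fun g v hv => by
      have h1 := LinearMap.congr_fun (hgT g) v
      have h2 : T v = 0 := hv
      rw [Module.End.mul_apply, h2, map_zero, LinearMap.smul_apply, Module.End.mul_apply,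
        eq_comm, smul_eq_zero] at h1
      refine h1.resolve_left fun h3 => ?_
      have : LinearMap.det (ρ g) * LinearMap.det (ρ g⁻¹) = 1 := by
        rw [← map_mul, ← map_mul, mul_inv_cancel, map_one, map_one]
      rw [h3, zero_mul] at this
      exact zero_ne_one this
    · exact hT0 (LinearMap.ext fun v => LinearMap.ker_eq_bot'.1 hb _ (LinearMap.congr_fun hTT v))
    · exact hT0 (LinearMap.ker_eq_top.1 ht)
  refine ⟨T, _, ht0, htrT, hsq htrT, hφT, hgT, fun D hD => ?_⟩
  have hDT : D * T = 0 := by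
    rw [hT, mul_sub, ← mul_assoc, ← mul_assoc, hA, hB, hD, hD]
    simp
  have : D * (T * T) = 0 := by rw [← mul_assoc, hDT, zero_mul]
  rw [hsq htrT, mul_smul_comm, mul_one] at this
  exact (smul_eq_zero.1 this).resolve_left ht0

/-- The triple is u, ru, r²u, where `r` is a nontrivial element of determinant 1 and `u` is fixed by
an element of determinant -1 if there is one. -/
theorem exists_permuted_triple (h2 : (2 : k) ≠ 0) (hV : Module.finrank k V = 2)
    (hρ : ρ.IsIrreducible) {φ : V →ₗ[k] Module.End k V} (hφi : Function.Injective φ)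
    (hφ : ∀ g v, φ (ρ g v) * ρ g = ρ g * φ v) :
    ∃ v : Fin 3 → V, LinearIndependent k ![v 0, v 1] ∧ ∑ i, v i = 0 ∧
      ∀ g i, ∃ j, ρ g (v i) = v j := by
  have : FiniteDimensional k V := .of_finrank_pos (by omega)
  have : Nontrivial V := Module.nontrivial_of_finrank_pos (R := k) (by omega)
  obtain ⟨T, t, ht, htr, hTT, hφT, hgT, hinj⟩ := exists_semi_invariant h2 hV hρ hφi hφ
  have hone : ∀ {x y : k}, x • (1 : Module.End k V) = y • (1 : Module.End k V) → x = y :=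
    fun h => smul_left_injective k one_ne_zero h
  have hT0 : T ≠ 0 := by
    rintro rfl
    rw [zero_mul, eq_comm, smul_eq_zero] at hTT
    exact hTT.elim ht one_ne_zero
  have hCH := fun g => Module.End.mul_self_of_finrank_eq_two hV (ρ g)
  have hinv : ∀ g, ρ g * ρ g⁻¹ = 1 := fun g => by rw [← map_mul, mul_inv_cancel, map_one]
  have hcancel : ∀ g (S : Module.End k V), S * ρ g = 0 → S = 0 := fun g S h => by
    rw [← mul_one S, ← hinv g, ← mul_assoc, h, zero_mul]
  have hdet : ∀ g, LinearMap.det (ρ g) = 1 ∨ LinearMap.det (ρ g) = -1 := by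
    intro g
    have h1 : ρ g * (T * T) = (LinearMap.det (ρ g) * LinearMap.det (ρ g)) • (T * T * ρ g) := by
      rw [← mul_assoc, hgT, smul_mul_assoc, mul_assoc T, hgT, mul_smul_comm, smul_smul, mul_assoc]
    rw [hTT, mul_smul_comm, mul_one, smul_mul_assoc, one_mul, smul_smul, ← sub_eq_zero,
      ← sub_smul, smul_eq_zero] at h1
    have hg0 : ρ g ≠ 0 := fun h0 => one_ne_zero (hcancel g 1 (by rw [h0, mul_zero]))
    have h3 := h1.resolve_right hg0
    have h4 : t * ((LinearMap.det (ρ g) - 1) * (LinearMap.det (ρ g) + 1)) = 0 := by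
      linear_combination -h3
    obtain h5 | h5 := mul_eq_zero.1 ((mul_eq_zero.1 h4).resolve_left ht)
    · exact .inl (sub_eq_zero.1 h5)
    · exact .inr (eq_neg_of_add_eq_zero_left h5)
  have hspan : ∀ u, u ≠ 0 → ∃ g, ∀ l : k, ρ g u ≠ l • u := by
    intro u hu
    by_contra! h
    choose l hl using h
    obtain hb | ht := hρ.eq_bot_or_eq_top_of_stable (k ∙ u) fun g v hv => by
      obtain ⟨a, rfl⟩ := Submodule.mem_span_singleton.1 hv
      rw [map_smul, hl]
      exact Submodule.smul_mem _ _ (Submodule.smul_mem _ _ (Submodule.mem_span_singleton_self u))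
    · exact hu (Submodule.span_singleton_eq_bot.1 hb)
    · have := finrank_span_singleton (K := k) hu
      rw [ht, finrank_top] at this
      omega
  -- Such a `g` commutes with T, so g = α + βT with inverse α - βT. As T anticommutes with the image
  -- of φ, equivariance becomes φ(gv) = g²φ(v), so g² satisfies g⁴ - 2αg² + 1 = 0. Comparison with
  -- the trace 4α² - 2 of g² gives (2α + 1)(α - 1) = 0.
  have hpos : ∀ g, LinearMap.det (ρ g) = 1 → ρ g ≠ 1 →
      ∃ β, β * β * t * 4 = -3 ∧ ρ g = (-(2 : k)⁻¹) • 1 + β • T := by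
    intro g hg hg1
    have hcomm : ρ g * T = T * ρ g := by rw [hgT, hg, one_smul]
    obtain ⟨c, hc⟩ := Module.End.mul_add_mul_of_finrank_eq_two hV (ρ g) T
    rw [htr, zero_smul, add_zero, ← hcomm] at hc
    obtain ⟨α, hα⟩ : ∃ α, α = LinearMap.trace k V (ρ g) / 2 := ⟨_, rfl⟩
    have htrα : LinearMap.trace k V (ρ g) = 2 * α := by rw [hα]; field_simp
    obtain ⟨β, hβ⟩ : ∃ β, β = c / (2 * t) := ⟨_, rfl⟩
    have hcβ : c = 2 * t * β := by rw [hβ]; field_simp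
    have hgαβ : ρ g = α • 1 + β • T := by
      have h1 : (ρ g * T + ρ g * T) * T = (LinearMap.trace k V (ρ g) • T + c • 1) * T := by rw [hc]
      rw [add_mul, mul_assoc, hTT, add_mul, smul_mul_assoc, smul_mul_assoc, hTT, one_mul,
        mul_smul_comm, mul_one, htrα, hcβ] at h1
      have h3 : (2 * t) • ρ g = (2 * t) • (α • (1 : Module.End k V) + β • T) := by
        linear_combination (norm := module) (1 : k) • h1
      exact smul_right_injective _ (mul_ne_zero h2 ht) h3
    have hsq : ρ g * ρ g = (α * α + β * β * t) • 1 + (2 * α * β) • T := by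
      rw [hgαβ]
      simp only [add_mul, mul_add, smul_mul_smul_comm, hTT, one_mul, mul_one]
      module
    have hαβ : α * α - β * β * t = 1 := by
      apply hone
      have := hCH g
      rw [hsq, hg, htrα] at this
      rw [hgαβ] at this
      linear_combination (norm := module) (-1 : k) • this
    obtain ⟨C, hC⟩ : ∃ C, C = α • (1 : Module.End k V) - β • T := ⟨_, rfl⟩
    have hgC : ρ g * C = 1 := by
      rw [hgαβ, hC]
      simp only [add_mul, mul_sub, smul_mul_smul_comm, hTT, one_mul, mul_one]
      have : (1 : Module.End k V) = (α * α - β * β * t) • 1 := by rw [hαβ, one_smul]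
      conv_rhs => rw [this]
      module
    have hφg : ∀ v, φ (ρ g v) = ρ g * ρ g * φ v := by
      intro v
      have h1 : ρ g * φ v = φ v * C := by
        rw [hgαβ, hC, add_mul, mul_sub, smul_mul_assoc, smul_mul_assoc, mul_smul_comm,
          mul_smul_comm, hφT]
        simp
      calc φ (ρ g v) = φ (ρ g v) * ρ g * C := by rw [mul_assoc, hgC, mul_one]
        _ = ρ g * ρ g * φ v := by rw [hφ, mul_assoc, ← h1, mul_assoc]
    have hg2 : ∀ v, ρ g (ρ g v) = (2 * α) • ρ g v - v := fun v => by
      have := LinearMap.congr_fun (hCH g) v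
      rwa [htrα, hg, one_smul] at this
    have hD : ρ g * ρ g * (ρ g * ρ g) - (2 * α) • (ρ g * ρ g) + 1 = 0 := by
      refine hinj _ fun v => ?_
      have h1 := hφg (ρ g v)
      rw [hg2, map_sub, map_smul, hφg] at h1
      rw [add_mul, sub_mul, one_mul, mul_assoc (ρ g * ρ g), smul_mul_assoc, ← h1]
      module
    have hg4 : ρ g * ρ g * (ρ g * ρ g) = (4 * α * α - 2) • (ρ g * ρ g) - 1 := by
      have e : ρ g * ρ g = (2 * α) • ρ g - 1 := by rw [hCH g, htrα, hg, one_smul]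
      have e' : (ρ g * ρ g) * ρ g = (2 * α) • (ρ g * ρ g) - ρ g := by
        conv_lhs => rw [e]
        rw [sub_mul, smul_mul_assoc, one_mul]
      calc ρ g * ρ g * (ρ g * ρ g) = ρ g * ρ g * ρ g * ρ g := by noncomm_ring
        _ = (2 * α) • (ρ g * ρ g * ρ g) - ρ g * ρ g := by
          rw [e', sub_mul, smul_mul_assoc, e']
        _ = (4 * α * α - 2) • (ρ g * ρ g) - 1 := by
          rw [e']
          linear_combination (norm := module) (1 : k) • e
    rw [hg4] at hD
    have hD' : (4 * α * α - 2 - 2 * α) • (ρ g * ρ g) = 0 := by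
      rw [← hD]; module
    have hgg : ρ g * ρ g ≠ 0 := fun h0 => one_ne_zero (hcancel g 1 (by
      rw [one_mul]; exact hcancel g _ h0))
    have h5 := (smul_eq_zero.1 hD').resolve_right hgg
    have h6 : 2 * ((2 * α + 1) * (α - 1)) = 0 := by linear_combination h5
    obtain h7 | h7 := mul_eq_zero.1 ((mul_eq_zero.1 h6).resolve_left h2)
    · have hα' : α = -(2 : k)⁻¹ := by
        field_simp
        linear_combination h7
      refine ⟨β, ?_, hα' ▸ hgαβ⟩
      linear_combination (-4) * hαβ + (2 * α - 1) * h7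
    · have hα1 : α = 1 := sub_eq_zero.1 h7
      have hβ0 : β = 0 := by
        have : β * β * t = 0 := by rw [hα1] at hαβ; linear_combination -hαβ
        exact mul_self_eq_zero.1 ((mul_eq_zero.1 this).resolve_right ht)
      exact absurd (by rw [hgαβ, hα1, hβ0]; simp) hg1
  -- An element of determinant -1 anticommutes with T, hence has trace 0 and is an involution. With
  -- `u` fixed by it, the orbit of `u` is already reached by elements of determinant 1.
  obtain ⟨u, hu, hred⟩ : ∃ u : V, u ≠ 0 ∧
      ∀ g, ∃ h, LinearMap.det (ρ h) = 1 ∧ ρ g u = ρ h u := by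
    by_cases hall : ∀ g, LinearMap.det (ρ g) = 1
    · obtain ⟨u, hu⟩ := exists_ne (0 : V)
      exact ⟨u, hu, fun g => ⟨g, hall g, rfl⟩⟩
    push Not at hall
    obtain ⟨s, hs⟩ := hall
    have hs := (hdet s).resolve_left hs
    have hsT : ρ s * T = -(T * ρ s) := by rw [hgT, hs, neg_one_smul]
    have hTs : T * ρ s ≠ 0 := fun h0 => hT0 (hcancel s T h0)
    have htrs : LinearMap.trace k V (ρ s) = 0 := by
      obtain ⟨c, hc⟩ := Module.End.mul_add_mul_of_finrank_eq_two hV (ρ s) T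
      rw [hsT, neg_add_cancel, htr, zero_smul, add_zero] at hc
      by_contra hne
      have hTc : T = (-(LinearMap.trace k V (ρ s))⁻¹ * c) • 1 := by
        apply smul_right_injective _ hne
        simp only [smul_smul]
        rw [← mul_assoc, mul_neg, mul_inv_cancel₀ hne]
        linear_combination (norm := module) (-1 : k) • hc
      have : (2 : k) • (T * ρ s) = 0 := by
        have h1 : ρ s * T = T * ρ s := by
          rw [hTc, mul_smul_comm, smul_mul_assoc, one_mul, mul_one]
        rw [h1] at hsT
        rw [two_smul]
        exact eq_neg_iff_add_eq_zero.1 hsT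
      exact hTs ((smul_eq_zero.1 this).resolve_left h2)
    have hss : ∀ v, ρ s (ρ s v) = v := fun v => by
      have := LinearMap.congr_fun (hCH s) v
      rw [htrs, hs] at this
      simpa using this
    obtain ⟨u, hu, hsu⟩ : ∃ u, u ≠ 0 ∧ ρ s u = u := by
      by_contra! h
      have : ρ s = -1 := by
        ext v
        by_contra hv
        refine h (ρ s v + v) (fun h0 => hv ?_) ?_
        · simpa using eq_neg_of_add_eq_zero_left h0
        · rw [map_add, hss, add_comm]
      rw [this] at hs
      have h1 := LinearMap.det_smul (-1 : k) (1 : Module.End k V)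
      rw [neg_one_smul, hs, hV, map_one] at h1
      apply h2
      linear_combination -h1
    refine ⟨u, hu, fun g => ?_⟩
    obtain hg | hg := hdet g
    · exact ⟨g, hg, rfl⟩
    · exact ⟨g * s, by rw [map_mul, map_mul, hg, hs]; ring, by rw [map_mul, Module.End.mul_apply, hsu]⟩
  obtain ⟨r, hr, hr1⟩ : ∃ r, LinearMap.det (ρ r) = 1 ∧ ρ r ≠ 1 := by
    by_contra! h
    obtain ⟨g, hg⟩ := hspan u hu
    obtain ⟨h', h1, h2⟩ := hred g
    exact hg 1 (by rw [h2, h h' h1, one_smul, Module.End.one_apply])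
  obtain ⟨β, hβ, hrβ⟩ := hpos r hr hr1
  have hrr : ρ r * ρ r = (-(2 : k)⁻¹) • 1 - β • T := by
    rw [hrβ]
    simp only [add_mul, mul_add, smul_mul_smul_comm, hTT, one_mul, mul_one, smul_smul]
    have e : (2 : k)⁻¹ * (2 : k)⁻¹ + β * β * t = -(2 : k)⁻¹ := by
      field_simp
      linear_combination hβ
    have e' : (2 : k)⁻¹ + (2 : k)⁻¹ = 1 := by field_simp; norm_num
    linear_combination (norm := module) e • (1 : Module.End k V) - (e' • (β • T))
  have hcases : ∀ h, LinearMap.det (ρ h) = 1 → ρ h = 1 ∨ ρ h = ρ r ∨ ρ h = ρ r * ρ r := by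
    intro h hh
    by_cases h1 : ρ h = 1
    · exact .inl h1
    obtain ⟨γ, hγ, hhγ⟩ := hpos h hh h1
    -- Both coefficients satisfy 4tβ² = -3, so γ = ±β, and the two signs are r and r².
    have h3 : (2 * 2 * t) * ((γ - β) * (γ + β)) = 0 := by linear_combination hγ - hβ
    obtain h4 | h4 := mul_eq_zero.1
      ((mul_eq_zero.1 h3).resolve_left (mul_ne_zero (mul_ne_zero h2 h2) ht))
    · right; left
      rw [hhγ, hrβ, sub_eq_zero.1 h4]
    · right; right
      rw [hhγ, hrr, eq_neg_of_add_eq_zero_left h4]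
      module
  have hsum : ∀ v, v + ρ r v + ρ r (ρ r v) = 0 := by
    intro v
    rw [← Module.End.mul_apply, hrr, hrβ]
    have e' : (2 : k)⁻¹ + (2 : k)⁻¹ = 1 := by field_simp; norm_num
    simp only [LinearMap.add_apply, LinearMap.sub_apply, LinearMap.smul_apply,
      Module.End.one_apply]
    linear_combination (norm := module) -(e' • v)
  have horbit : ∀ g, ρ g u = u ∨ ρ g u = ρ r u ∨ ρ g u = ρ r (ρ r u) := by
    intro g
    obtain ⟨h, hh, hgh⟩ := hred g
    rw [hgh]
    obtain h1 | h1 | h1 := hcases h hh <;> rw [h1]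
    exacts [.inl rfl, .inr (.inl rfl), .inr (.inr rfl)]
  refine ⟨![u, ρ r u, ρ r (ρ r u)], ?_, ?_, fun g i => ?_⟩
  · change LinearIndependent k ![u, ρ r u]
    rw [LinearIndependent.pair_iff' hu]
    intro l hl
    obtain ⟨g, hg⟩ := hspan u hu
    obtain h | h | h := horbit g
    · exact hg 1 (by rw [h, one_smul])
    · exact hg l (by rw [h, hl])
    · exact hg (l * l) (by rw [h, ← hl, map_smul, ← hl, smul_smul])
  · simpa [Fin.sum_univ_three] using hsum u
  · have key : ∀ g, ∃ j, ρ g u = ![u, ρ r u, ρ r (ρ r u)] j := fun g => by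
      obtain h | h | h := horbit g
      exacts [⟨0, h⟩, ⟨1, h⟩, ⟨2, h⟩]
    fin_cases i
    · exact key g
    · simpa using key (g * r)
    · simpa using key (g * r * r)

end EquivariantEndomorphisms

/-! ### The irreducible case and the equivalence. -/

theorem tautologicalRep_injective {k V : Type*} [CommRing k] [AddCommGroup V] [Module k V]
    (G : Subgroup (LinearMap.GeneralLinearGroup k V)) :
    Function.Injective (tautologicalRep G) :=
  Units.val_injective.comp Subtype.val_injective

theorem irreducible_of_not_le_symmetricGroup {p : ℕ} [Fact p.Prime] {V : Type} [AddCommGroup V]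
    [Module (ZMod p) V] (hV : Module.finrank (ZMod p) V = 2)
    (G : Subgroup (LinearMap.GeneralLinearGroup (ZMod p) V))
    (hirr : (tautologicalRep G).IsIrreducible) (hp : 2 < p)
    (hG : ¬ ∃ H : Subgroup (LinearMap.GeneralLinearGroup (ZMod p) V),
      G ≤ H ∧ Nonempty (H ≃* Equiv.Perm (Fin 3))) :
    ¬ HaveCommonIrreducibleFactor (tautologicalRep G)
      (linHom (tautologicalRep G) (tautologicalRep G)) ∧
    Subsingleton (groupCohomology.H1 (Rep.of (tautologicalRep G))) := by
  have : FiniteDimensional (ZMod p) V := .of_finrank_pos (by omega)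
  have : Finite V := Module.finite_of_finite (ZMod p)
  have : Finite (V →ₗ[ZMod p] V) := Module.finite_of_finite (ZMod p)
  have : Finite G := inferInstance
  have := Fintype.ofFinite G
  have h2 : (2 : ZMod p) ≠ 0 := by
    intro h
    have := (ZMod.natCast_eq_zero_iff 2 p).1 (by exact_mod_cast h)
    exact absurd (Nat.le_of_dvd two_pos this) (by omega)
  -- Cauchy's theorem supplies an element of order p in the first case; Maschke applies in the
  -- second.
  by_cases hcard : (Fintype.card G : ZMod p) = 0
  · obtain ⟨x, hx⟩ := exists_prime_orderOf_dvd_card p ((ZMod.natCast_eq_zero_iff _ _).1 hcard)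
    have hx1 : tautologicalRep G x ≠ 1 := fun h => by
      have : x = 1 := tautologicalRep_injective G (h.trans (map_one _).symm)
      rw [this, orderOf_one] at hx
      omega
    obtain ⟨z, hz⟩ := exists_eq_neg_one_of_pow_eq_one hV hirr hx1
      (orderOf_dvd_iff_pow_eq_one.1 hx.dvd)
    exact ⟨not_haveCommonIrreducibleFactor_of_neg_one h2 hz,
      subsingleton_H1_of_neg_one h2 (tautologicalRep_injective G) hz⟩
  · refine ⟨fun h => hG ?_, subsingleton_H1_of_card_ne_zero hcard _⟩
    obtain ⟨φ, hφ⟩ := h.exists_injective hcard hirr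
    have hφg : ∀ g v, φ.toLinearMap (tautologicalRep G g v) * tautologicalRep G g =
        tautologicalRep G g * φ.toLinearMap v := fun g v => by
      have h1 : φ (tautologicalRep G g v) =
          tautologicalRep G g * (φ v * tautologicalRep G g⁻¹) := φ.isIntertwining _ _ g v
      rw [IntertwiningMap.toLinearMap_apply, h1, mul_assoc, mul_assoc, ← map_mul,
        inv_mul_cancel, map_one, mul_one]
      rfl
    obtain ⟨v, hli, hsum, hv⟩ := exists_permuted_triple h2 hV hirr (φ := φ.toLinearMap) hφ hφg
    exact exists_le_symmetricGroup_of_permutes hV G v hli hsum fun g hg => hv ⟨g, hg⟩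

theorem theorem7p1 (p : ℕ) [Fact p.Prime] (V : Type) [AddCommGroup V] [Module (ZMod p) V]
    (hV : Module.finrank (ZMod p) V = 2)
    (G : Subgroup (LinearMap.GeneralLinearGroup (ZMod p) V)) :
    ((¬ HaveCommonIrreducibleFactor (tautologicalRep G)
          (Representation.linHom (tautologicalRep G) (tautologicalRep G)) ∧
        Subsingleton (groupCohomology.H1 (Rep.of (tautologicalRep G)))) ↔
      ((¬ ∃ H : Subgroup (LinearMap.GeneralLinearGroup (ZMod p) V),
            G ≤ H ∧ Nonempty (H ≃* Equiv.Perm (Fin 3))) ∧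
        ∀ χ₁ χ₂ : G →* (ZMod p)ˣ, IsExtensionOfCharacters (tautologicalRep G) χ₁ χ₂ →
          (χ₁ ≠ 1 ∧ χ₁ ≠ χ₂ ^ 2) ∧ (χ₂ ≠ 1 ∧ χ₂ ≠ χ₁ ^ 2))) ∧
    ((¬ ∃ H : Subgroup (LinearMap.GeneralLinearGroup (ZMod p) V),
        G ≤ H ∧ Nonempty (H ≃* Equiv.Perm (Fin 3))) → 2 < p) := by
  refine ⟨⟨fun ⟨h, _⟩ => ⟨?_, fun χ₁ χ₂ hχ => ⟨⟨?_, ?_⟩, ?_, ?_⟩⟩, fun ⟨hG, hχ⟩ => ?_⟩,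
    two_lt_of_not_le_symmetricGroup p hV G⟩
  · rintro ⟨H, hGH, ⟨e⟩⟩
    exact h (haveCommonIrreducibleFactor_of_le_symmetricGroup hV hGH e)
  · exact fun h1 => h (hχ.haveCommonIrreducibleFactor (.inl h1))
  · exact fun h1 => h (hχ.haveCommonIrreducibleFactor (.inr (.inl h1)))
  · exact fun h1 => h (hχ.haveCommonIrreducibleFactor (.inr (.inr (.inl h1))))
  · exact fun h1 => h (hχ.haveCommonIrreducibleFactor (.inr (.inr (.inr h1))))
  · by_cases hirr : (tautologicalRep G).IsIrreducible
    · exact irreducible_of_not_le_symmetricGroup hV G hirr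
        (two_lt_of_not_le_symmetricGroup p hV G hG) hG
    · obtain ⟨χ₁, χ₂, hext⟩ := exists_isExtensionOfCharacters hV hirr
      obtain ⟨⟨h1, h12⟩, h2, h21⟩ := hχ χ₁ χ₂ hext
      exact ⟨hext.not_haveCommonIrreducibleFactor h1 h12 h2 h21,
        hext.subsingleton_H1 (tautologicalRep_injective G) h1 h12 h2⟩
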